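/- Let $N\ge 1$, $c_N=\pi^{-N/2}\Gamma(N/2)$ and $\rho_N=2\log 2+\psi(N/2)-\gamma$, where $\psi=\Gamma'/\Gamma$ is the digamma function and $\gamma$ is the Euler--Mascheroni constant. Set $k(z)=c_N|z|^{-N}\chi_{B_1}(z)$, $j(z)=c_N|z|^{-N}\chi_{\mathbb R^N\setminus B_1}(z)$, $$\mathcal E(u,v)=\frac12\iint_{\mathbb R^N\times\mathbb R^N}(u(x)-u(y))(v(x)-v(y))k(x-y)\,dx\,dy,$$ $$\mathcal E_L(u,v)=\mathcal E(u,v)-\iint_{\mathbb R^N\times\mathbb R^N}u(x)v(y)j(x-y)\,dx\,dy+\rho_N\int_{\mathbb R^N}uv\,dx .$$ Let $\mathbb H(\mathbb R^N)$ be the space of $u\in L^2(\mathbb R^N)$ with $\mathcal E(u,u)<\infty$ and, for $\Omega\subset\mathbb R^N$ open, let $\mathbb H(\Omega)$ be the set of $u\in\mathbb H(\mathbb R^N)$ with $u=0$ a.e. in $\mathbb R^N\setminus\Omega$. For $\Omega$ bounded and open, $g\in L^2(\Omega)$ and $u\in\mathbb H(\mathbb R^N)$, we say that $L_\Delta u\ge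 g$ in $\Omega$ in the weak sense if $\mathcal E_L(u,v)\ge\int_\Omega gv\,dx$ for every nonnegative $v\in\mathbb H(\Omega)$. For $\varphi\in C_c^\infty(\mathbb R^N)$ the logarithmic Laplacian is given pointwise by $$L_\Delta\varphi(x)=c_N\int_{\mathbb R^N}\frac{\varphi(x)\chi_{B_1(x)}(y)-\varphi(y)}{|x-y|^N}\,dy+\rho_N\varphi(x).$$ Let $H^+=\{x_1>0\}$, let $B_\rho$ be the open ball of radius $\rho$ centred at $0$, and $B_\rho^+=B_\rho\cap H^+$. A measurable function is $e_1$-antisymmetric if $u(-x_1,x_2,\dots,x_N)=-u(x)$ for a.e. $x$. Given $r>0$ and $V\in L^\infty(B_{2r}^+)$, a barrier for $V$ at scale $r$ is an $e_1$-antisymmetric function $\phi\in C_c^\infty(\mathbb R^N)$ such that $$L_\Delta\phi\le V\phi\ \text{ a.e. in } B_{2r}^+\setminus B_{r/2}(re_1),\quad \phi=0\ \text{ in } H^+\setminus B_{2r}^+,\quad \phi\le 1\ \text{ in } B_{r/2}(re_1),\quad \partial_1\phi(0)>0 .$$ **Lemma (Hopf-type lemma on the symmetry hyperplane).** Let $R>0$,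 let $V\in L^\infty(B_R^+)$, and let $u\in\mathbb H(\mathbb R^N)\cap C(B_R^+)$ be an $e_1$-antisymmetric function such that $L_\Delta u\ge Vu$ in $B_R^+$ in the weak sense, $u>0$ in $B_R^+$, and $u\ge 0$ a.e. in $H^+$. Then there is $r_0\in(0,R/2]$ such that for every $r\in(0,r_0]$ a barrier for $V$ at scale $r$ exists, and for every such barrier $\phi$ there is $\varepsilon_0>0$ such that for every $\varepsilon\in(0,\varepsilon_0]$ $$u\ge\varepsilon\phi\qquad\text{in } B_{2r}^+ .$$ In particular, $$\liminf_{h\to0^+}\frac{u(he_1)}{h}>0,$$ where the value $+\infty$ is allowed. -/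

import Mathlib

noncomputable section

namespace LogLap

open MeasureTheory Metric
open scoped ContDiff

/-- `ℝ^N` with the Euclidean norm and Lebesgue measure. -/
abbrev E (N : ℕ) : Type := EuclideanSpace ℝ (Fin N)

/-- The constant `c_N = π^{-N/2} Γ(N/2)`. -/
def cConst (N : ℕ) : ℝ := Real.pi ^ (-(N : ℝ) / 2) * Real.Gamma ((N : ℝ) / 2)

/-- The constant `ρ_N = 2 log 2 + ψ(N/2) - γ`, where `ψ = Γ'/Γ` is the digamma function and `γ` is
the Euler-Mascheroni constant. -/
def rhoConst (N : ℕ) : ℝ :=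
  2 * Real.log 2 + logDeriv Real.Gamma ((N : ℝ) / 2) - Real.eulerMascheroniConstant

/-- The near kernel `k(z) = c_N |z|^{-N} χ_{B_1}(z)`. -/
def kKer (N : ℕ) (z : E N) : ℝ :=
  (ball (0 : E N) 1).indicator (fun z => cConst N / ‖z‖ ^ N) z

/-- The far kernel `j(z) = c_N |z|^{-N} χ_{B_1^c}(z)`. -/
def jKer (N : ℕ) (z : E N) : ℝ :=
  ((ball (0 : E N) 1)ᶜ).indicator (fun z => cConst N / ‖z‖ ^ N) z

/-- Membership in `ℍ(ℝ^N)`: `u ∈ L²(ℝ^N)` and the (nonnegative) integrand of `𝓔(u,u)` has finite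
integral. -/
structure MemH {N : ℕ} (u : E N → ℝ) : Prop where
  memLp : MemLp u 2 volume
  energy : Integrable (fun p : E N × E N => (u p.1 - u p.2) ^ 2 * kKer N (p.1 - p.2))
    (volume.prod volume)

/-- Membership in `ℍ(Ω)`: `u ∈ ℍ(ℝ^N)` and `u = 0` a.e. in the complement of `Ω`. -/
structure MemHOn {N : ℕ} (Ω : Set (E N)) (u : E N → ℝ) : Prop where
  memH : MemH u
  zero_compl : ∀ᵐ x ∂(volume : Measure (E N)), x ∉ Ω → u x = 0

/-- The form `𝓔(u,v) = ½ ∬ (u(x) - u(y)) (v(x) - v(y)) k(x - y) dx dy`. -/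
def energyForm {N : ℕ} (u v : E N → ℝ) : ℝ :=
  (1 / 2) * ∫ p : E N × E N, (u p.1 - u p.2) * (v p.1 - v p.2) * kKer N (p.1 - p.2)
    ∂(volume.prod volume)

/-- The form of the logarithmic Laplacian,
`𝓔_L(u,v) = 𝓔(u,v) - ∬ u(x) v(y) j(x - y) dx dy + ρ_N ∫ u v dx`. -/
def logForm {N : ℕ} (u v : E N → ℝ) : ℝ :=
  energyForm u v
    - (∫ p : E N × E N, u p.1 * v p.2 * jKer N (p.1 - p.2) ∂(volume.prod volume))
    + rhoConst N * ∫ x, u x * v x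

/-- `L_Δ u ≥ g` in `Ω` in the weak sense: `u ∈ ℍ(ℝ^N)` and `𝓔_L(u,v) ≥ ∫_Ω g v` for every
nonnegative `v ∈ ℍ(Ω)` (for `Ω` bounded and open, `g ∈ L²(Ω)`). -/
structure IsWeakSupersolution {N : ℕ} (Ω : Set (E N)) (g u : E N → ℝ) : Prop where
  memH : MemH u
  le_form : ∀ v : E N → ℝ, MemHOn Ω v → (∀ᵐ x ∂(volume : Measure (E N)), 0 ≤ v x) →
    ∫ x in Ω, g x * v x ≤ logForm u v

/-- The pointwise logarithmic Laplacian,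
`L_Δ u(x) = c_N ∫ (u(x) χ_{B_1(x)}(y) - u(y)) / |x - y|^N dy + ρ_N u(x)`. -/
def logLaplacian {N : ℕ} (u : E N → ℝ) (x : E N) : ℝ :=
  cConst N * (∫ y, ((ball x 1).indicator (fun _ => u x) y - u y) / ‖x - y‖ ^ N)
    + rhoConst N * u x

/-- The first coordinate vector `e_1`. -/
def e1 (N : ℕ) [NeZero N] : E N := EuclideanSpace.single 0 1

/-- `u` is `e`-antisymmetric: `u(x̄) = -u(x)` for a.e. `x`, where `x̄` is the reflection of `x`
across the hyperplane `{x · e = 0}`. -/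
def Antisymmetric {N : ℕ} (e : E N) (u : E N → ℝ) : Prop :=
  ∀ᵐ x ∂(volume : Measure (E N)), u ((Submodule.span ℝ {e})ᗮ.reflection x) = -u x

/-- The half-space `H⁺ = {x_1 > 0}`. -/
def halfSpace (N : ℕ) [NeZero N] : Set (E N) := {x | 0 < x 0}

/-- The half-ball `B_ρ⁺ = B_ρ(0) ∩ H⁺`. -/
def halfBall (N : ℕ) [NeZero N] (ρ : ℝ) : Set (E N) := ball 0 ρ ∩ halfSpace N

/-- `φ` is a barrier for the potential `V` at scale `r`. Since `V` is an element of an `L^∞` space,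
the pointwise inequality `L_Δ φ ≤ V φ` is required at almost every point. -/
structure IsBarrier {N : ℕ} [NeZero N] (V : E N → ℝ) (r : ℝ) (φ : E N → ℝ) : Prop where
  smooth : ContDiff ℝ ∞ φ
  compactSupport : HasCompactSupport φ
  antisymmetric : Antisymmetric (e1 N) φ
  subsolution : ∀ᵐ x ∂(volume : Measure (E N)),
    x ∈ halfBall N (2 * r) \ ball (r • e1 N) (r / 2) → logLaplacian φ x ≤ V x * φ x
  eq_zero : ∀ x ∈ halfSpace N \ halfBall N (2 * r), φ x = 0
  le_one : ∀ x ∈ ball (r • e1 N) (r / 2), φ x ≤ 1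
  deriv_pos : 0 < fderiv ℝ φ 0 (e1 N)

end LogLap

end

noncomputable section

namespace LogLap

open MeasureTheory Metric Set Filter Topology
open scoped ContDiff

/-! The proof compares `u` with `ε φ` by a maximum principle for antisymmetric functions on small
half-balls. Let `w = u - ε φ` and let `v` be the negative part of `w` in `H⁺`, extended by zero. If
`ε` is at most the minimum of `u` on the closed ball of radius `r/2` about `r e₁`, then `v` vanishes
there because `φ ≤ 1`, and it vanishes outside `B_{2r}⁺` because `φ = 0` and `u ≥ 0` in the rest of
`H⁺`. So `v` is admissible in the weak inequality for `u` and lives where `L_Δ φ ≤ V φ`; with `|V| ≤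
M` this gives `𝓔_L(w,v) ≥ -M ∫ v²`.

In the other direction, folding the integrals across the hyperplane gives `𝓔_L(w,v) ≤ -𝓔_L(v,v)`
(`logForm_negPartHalf_le`). The kernel `|z|^{-N}` just fails to be integrable at 0, so on functions
supported in `B_{2r}` the form `𝓔_L` dominates `(T + ρ_N) ∫ v²`, where `T` is the integral of `k`
outside `B_{4r}` and tends to infinity as `r → 0` (`le_logForm_of_small_support`,
`tendsto_integral_truncKer`). For small `r` this forces `v = 0` (`IsBarrier.mul_le`).

A barrier is a multiple of `α ψ + η`. Here `η` is an antisymmetrized bump at `r e₁`, with `L_Δ η ≤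
-κ x₁` away from the bump, and `ψ` is odd and equals `2 x₁` near 0. Both `ψ` and `L_Δ ψ` are
`O(|x₁|)`, so for small `α` the bump absorbs them, while `ψ` supplies the positive slope at 0
(`exists_isBarrier`). -/

/-- The reflection across the hyperplane `{x₁ = 0}`. -/
abbrev hyperRefl (N : ℕ) [NeZero N] : E N ≃ₗᵢ[ℝ] E N :=
  (Submodule.span ℝ {e1 N})ᗮ.reflection

/-! ### Geometry of the reflection across the hyperplane. -/

section Reflection

variable {N : ℕ} [NeZero N]

lemma inner_e1 (x : E N) : inner ℝ (e1 N) x = x 0 := by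
  simp [e1, EuclideanSpace.inner_single_left]

lemma norm_e1 : ‖e1 N‖ = 1 := by simp [e1]

lemma e1_apply_zero : (e1 N) 0 = 1 := by simp [e1]

lemma hyperRefl_apply (x : E N) : hyperRefl N x = x - (2 * x 0) • e1 N := by
  rw [hyperRefl, Submodule.reflection_orthogonal_apply, Submodule.reflection_singleton_apply,
    inner_e1, norm_e1]
  simp [mul_smul, two_smul]

lemma hyperRefl_coord (x : E N) : (hyperRefl N x) 0 = -x 0 := by
  rw [hyperRefl_apply]
  simp [e1_apply_zero]
  ring

lemma hyperRefl_hyperRefl (x : E N) : hyperRefl N (hyperRefl N x) = x :=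
  Submodule.reflection_reflection _ x

lemma norm_hyperRefl (x : E N) : ‖hyperRefl N x‖ = ‖x‖ := LinearIsometryEquiv.norm_map _ x

lemma norm_hyperRefl_sub (x y : E N) : ‖hyperRefl N x - y‖ = ‖x - hyperRefl N y‖ := by
  rw [← norm_hyperRefl (x - hyperRefl N y), map_sub, hyperRefl_hyperRefl]

/-- All comparisons between the kernel and its reflection rest on this identity: the sign of `x₁ y₁`
decides which of `y` and its mirror image is closer to `x`. -/
lemma norm_sub_hyperRefl_sq (x y : E N) :
    ‖x - hyperRefl N y‖ ^ 2 = ‖x - y‖ ^ 2 + 4 * (x 0 * y 0) := by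
  have h : x - hyperRefl N y = (x - y) + (2 * y 0) • e1 N := by
    rw [hyperRefl_apply]; abel
  rw [h, norm_add_sq_real, inner_smul_right, real_inner_comm, inner_e1, norm_smul, norm_e1]
  simp only [PiLp.sub_apply, Real.norm_eq_abs, mul_one, sq_abs]
  ring

lemma abs_coord_le_norm (x : E N) : |x 0| ≤ ‖x‖ := by
  simpa using EuclideanSpace.norm_eq x ▸ (PiLp.norm_apply_le x 0)

lemma measurePreserving_hyperRefl :
    MeasurePreserving (hyperRefl N) (volume : Measure (E N)) volume :=
  LinearIsometryEquiv.measurePreserving _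

lemma isOpen_halfSpace : IsOpen (halfSpace N) :=
  isOpen_lt continuous_const (by fun_prop)

lemma isOpen_halfBall (ρ : ℝ) : IsOpen (halfBall N ρ) :=
  isOpen_ball.inter isOpen_halfSpace

end Reflection

/-! ### Monotonicity and integrability of the near, far and truncated kernels. -/

section Kernels

variable {N : ℕ}

lemma cConst_pos [NeZero N] : 0 < cConst N := by
  have : (0 : ℝ) < N := Nat.cast_pos.2 (NeZero.pos N)
  exact mul_pos (Real.rpow_pos_of_pos Real.pi_pos _) (Real.Gamma_pos_of_pos (by positivity))

lemma kKer_eq (z : E N) : kKer N z = if ‖z‖ < 1 then cConst N / ‖z‖ ^ N else 0 := by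
  simp [kKer, indicator]

lemma jKer_eq (z : E N) : jKer N z = if ‖z‖ < 1 then 0 else cConst N / ‖z‖ ^ N := by
  simp only [jKer, indicator, mem_compl_iff, mem_ball_zero_iff]
  split_ifs <;> simp_all

lemma kKer_add_jKer (z : E N) : kKer N z + jKer N z = cConst N / ‖z‖ ^ N := by
  rw [kKer_eq, jKer_eq]; split_ifs <;> simp

lemma kKer_congr {z z' : E N} (h : ‖z‖ = ‖z'‖) : kKer N z = kKer N z' := by
  rw [kKer_eq, kKer_eq, h]

lemma jKer_congr {z z' : E N} (h : ‖z‖ = ‖z'‖) : jKer N z = jKer N z' := by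
  rw [jKer_eq, jKer_eq, h]

lemma kKer_sub_comm (x y : E N) : kKer N (x - y) = kKer N (y - x) :=
  kKer_congr (norm_sub_rev x y)

lemma jKer_sub_comm (x y : E N) : jKer N (x - y) = jKer N (y - x) :=
  jKer_congr (norm_sub_rev x y)

lemma measurable_kKer : Measurable (kKer N) :=
  Measurable.indicator (by fun_prop) measurableSet_ball

lemma measurable_jKer : Measurable (jKer N) :=
  Measurable.indicator (by fun_prop) measurableSet_ball.compl

variable [NeZero N]

lemma kKer_nonneg (z : E N) : 0 ≤ kKer N z := by
  rw [kKer_eq]; have := cConst_pos (N := N); split_ifs <;> positivity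

lemma jKer_nonneg (z : E N) : 0 ≤ jKer N z := by
  rw [jKer_eq]; have := cConst_pos (N := N); split_ifs <;> positivity

lemma jKer_le (z : E N) : jKer N z ≤ cConst N := by
  rw [jKer_eq]; have := cConst_pos (N := N)
  split_ifs with h
  · exact this.le
  · exact div_le_self this.le (one_le_pow₀ (not_lt.1 h))

/-- The point `z = 0` has to be excluded: division by zero gives `kKer N 0 = 0`. -/
lemma kKer_anti {z z' : E N} (h0 : z ≠ 0) (h : ‖z‖ ≤ ‖z'‖) : kKer N z' ≤ kKer N z := by
  rw [kKer_eq, kKer_eq]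
  have hc := (cConst_pos (N := N)).le
  have hz : 0 < ‖z‖ := norm_pos_iff.2 h0
  split_ifs with h1 h2 h2
  · gcongr
  · linarith
  · positivity
  · rfl

lemma integrable_fun_norm_iff (f : ℝ → ℝ) :
    Integrable (fun z : E N => f ‖z‖) ↔ IntegrableOn (fun y : ℝ => y ^ (N - 1) * f y) (Ioi 0) := by
  have : Nontrivial (E N) := ⟨e1 N, 0, by
    rw [← norm_pos_iff, norm_e1]; exact one_pos⟩
  simpa using integrable_fun_norm_addHaar (E := E N) (volume : Measure (E N)) (f := f)

lemma pow_pred_mul (y : ℝ) : y ^ N = y ^ (N - 1) * y := by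
  rw [← pow_succ, Nat.sub_add_cancel (NeZero.one_le)]

lemma integrable_norm_mul_kKer : Integrable (fun z : E N => ‖z‖ * kKer N z) := by
  have h : (fun z : E N => ‖z‖ * kKer N z) =
      fun z => (fun y : ℝ => y * if y < 1 then cConst N / y ^ N else 0) ‖z‖ := by
    ext z; simp only [kKer_eq]
  rw [h]
  refine (integrable_fun_norm_iff (N := N)
    (fun y : ℝ => y * if y < 1 then cConst N / y ^ N else 0)).2 ?_
  have h2 : IntegrableOn (fun _ : ℝ => cConst N) (Ioo 0 1) := by
    simp
  rw [← integrable_indicator_iff measurableSet_Ioo] at h2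
  refine h2.integrableOn.congr_fun (fun y hy => ?_) measurableSet_Ioi
  have hy0 : (0 : ℝ) < y := hy
  simp only [indicator, mem_Ioo, hy0, true_and]
  split_ifs with h1
  · rw [pow_pred_mul (N := N) y]; field_simp
  · simp

lemma integrable_norm_sq_mul_kKer : Integrable (fun z : E N => ‖z‖ ^ 2 * kKer N z) := by
  refine integrable_norm_mul_kKer.mono'
    ((continuous_norm.pow 2).measurable.mul measurable_kKer).aestronglyMeasurable
    (Eventually.of_forall fun z => ?_)
  have hk := kKer_nonneg z
  rw [Real.norm_of_nonneg (by positivity)]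
  by_cases h : ‖z‖ < 1
  · gcongr; nlinarith [norm_nonneg z]
  · simp [kKer_eq, h]

/-- The far kernel is not integrable, only square integrable: in polar coordinates its square has
density of order `y^{-N-1} ≤ y^{-2}` for `y ≥ 1`. -/
lemma integrable_jKer_sq : Integrable (fun z : E N => jKer N z ^ 2) := by
  have h : (fun z : E N => jKer N z ^ 2) =
      fun z => (fun y : ℝ => (if y < 1 then 0 else cConst N / y ^ N) ^ 2) ‖z‖ := by
    ext z; simp only [jKer_eq]
  rw [h]
  refine (integrable_fun_norm_iff (N := N)
    (fun y : ℝ => (if y < 1 then 0 else cConst N / y ^ N) ^ 2)).2 ?_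
  -- The endpoint `1/2` is any number in `(0,1)`, so that the open half-line contains `y = 1`.
  have h2 : IntegrableOn (fun y : ℝ => cConst N ^ 2 * y ^ (-2 : ℝ)) (Ioi (1/2)) :=
    (integrableOn_Ioi_rpow_of_lt (by norm_num) (by norm_num)).const_mul _
  rw [← integrable_indicator_iff measurableSet_Ioi] at h2
  refine h2.integrableOn.mono' (Measurable.aestronglyMeasurable ?_) ?_
  · refine Measurable.mul (by fun_prop) (Measurable.pow_const ?_ 2)
    exact Measurable.ite measurableSet_Iio measurable_const (by fun_prop)
  refine (ae_restrict_iff' measurableSet_Ioi).2 (Eventually.of_forall fun y hy => ?_)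
  have hy0 : (0 : ℝ) < y := hy
  split_ifs with h1
  · simp only [ne_eq, OfNat.ofNat_ne_zero, not_false_eq_true, zero_pow, mul_zero, norm_zero]
    exact indicator_nonneg (fun z hz => by
      have : (0 : ℝ) < z := lt_trans (by norm_num) hz
      positivity) _
  · have h3 : (1 : ℝ) ≤ y := not_lt.1 h1
    rw [indicator_of_mem (show y ∈ Ioi (1/2 : ℝ) from lt_of_lt_of_le (by norm_num) h3),
      Real.norm_of_nonneg (by positivity), Real.rpow_neg hy0.le, Real.rpow_two, div_pow,
      ← mul_div_assoc, mul_comm, mul_div_assoc]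
    gcongr
    rw [div_le_iff₀ (by positivity), ← div_eq_inv_mul, le_div_iff₀ (by positivity),
      pow_pred_mul (N := N) y]
    have : (1 : ℝ) ≤ y ^ (N - 1) := one_le_pow₀ h3
    nlinarith [mul_pos hy0 hy0, mul_nonneg (mul_pos hy0 hy0).le (sub_nonneg.2 this),
      mul_nonneg (mul_nonneg (mul_pos hy0 hy0).le (sub_nonneg.2 this)) (zero_le_one.trans this)]

/-- The near kernel with the ball of radius `a` removed. -/
def truncKer (N : ℕ) (a : ℝ) (z : E N) : ℝ := ((ball (0 : E N) a)ᶜ).indicator (kKer N) z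

omit [NeZero N] in
lemma truncKer_eq (a : ℝ) (z : E N) : truncKer N a z = if ‖z‖ < a then 0 else kKer N z := by
  simp only [truncKer, indicator, mem_compl_iff, mem_ball_zero_iff]
  split_ifs <;> simp_all

lemma truncKer_nonneg (a : ℝ) (z : E N) : 0 ≤ truncKer N a z :=
  indicator_nonneg (fun z _ => kKer_nonneg z) z

lemma truncKer_le (a : ℝ) (z : E N) : truncKer N a z ≤ kKer N z :=
  indicator_le_self' (fun z _ => kKer_nonneg z) z

lemma integrable_truncKer {a : ℝ} (ha : 0 < a) : Integrable (truncKer N a) := by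
  refine (integrable_norm_mul_kKer.div_const a).mono'
    (measurable_kKer.indicator measurableSet_ball.compl).aestronglyMeasurable
    (Eventually.of_forall fun z => ?_)
  rw [Real.norm_of_nonneg (truncKer_nonneg a z), truncKer_eq, le_div_iff₀ ha]
  have := kKer_nonneg z
  split_ifs with h
  · simp only [zero_mul]; positivity
  · rw [mul_comm]; gcongr; exact not_lt.1 h

lemma integral_truncKer {a : ℝ} (ha : 0 < a) (ha1 : a ≤ 1) :
    ∫ z, truncKer N a z = (N * volume.real (ball (0 : E N) 1) * cConst N) * -Real.log a := by
  have h : truncKer N a =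
      fun z => (fun y : ℝ => if y < a then 0 else if y < 1 then cConst N / y ^ N else 0) ‖z‖ := by
    ext z; simp only [truncKer_eq, kKer_eq]
  have : Nontrivial (E N) := ⟨e1 N, 0, by
    rw [← norm_pos_iff, norm_e1]; exact one_pos⟩
  rw [h, integral_fun_norm_addHaar (E := E N) volume]
  have h2 : ∫ y in Ioi (0 : ℝ), y ^ (Module.finrank ℝ (E N) - 1) •
      (if y < a then 0 else if y < 1 then cConst N / y ^ N else 0)
      = ∫ y in Ioi (0 : ℝ), (Ico a 1).indicator (fun y => cConst N * y⁻¹) y := by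
    refine setIntegral_congr_fun measurableSet_Ioi fun y hy => ?_
    have hy0 : (0 : ℝ) < y := hy
    simp only [indicator, mem_Ico, finrank_euclideanSpace, Fintype.card_fin, smul_eq_mul]
    split_ifs with h1 h2 h3 h4 h5
    · linarith [h2.1]
    · simp
    · rw [pow_pred_mul (N := N) y]; field_simp
    · exact absurd ⟨not_lt.1 h1, h3⟩ h4
    · exact absurd h5.2 h3
    · simp
  rw [h2, setIntegral_indicator measurableSet_Ico,
    inter_eq_self_of_subset_right (show Ico a 1 ⊆ Ioi 0 from fun y hy => lt_of_lt_of_le ha hy.1),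
    integral_Ico_eq_integral_Ioo,
    ← integral_Ioc_eq_integral_Ioo, ← intervalIntegral.integral_of_le ha1,
    intervalIntegral.integral_const_mul, integral_inv_of_pos ha one_pos]
  simp [Real.log_inv]
  ring

/-- The logarithmic divergence of the kernel at 0 is the source of coercivity on small sets. -/
lemma tendsto_integral_truncKer :
    Tendsto (fun a : ℝ => ∫ z, truncKer N a z) (𝓝[>] 0) atTop := by
  have hpos : 0 < N * volume.real (ball (0 : E N) 1) * cConst N := by
    have h1 : (0 : ℝ) < N := Nat.cast_pos.2 (NeZero.pos N)
    have h2 : 0 < volume.real (ball (0 : E N) 1) :=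
      ENNReal.toReal_pos (measure_ball_pos _ _ one_pos).ne' measure_ball_lt_top.ne
    exact mul_pos (mul_pos h1 h2) cConst_pos
  refine ((tendsto_neg_atBot_atTop.comp Real.tendsto_log_nhdsGT_zero).const_mul_atTop hpos).congr' ?_
  filter_upwards [Ioc_mem_nhdsGT (zero_lt_one' ℝ)] with a ha
  exact (integral_truncKer ha.1 ha.2).symm

end Kernels

/-! ### Integrability of the integrands and linearity of the form in its first argument. -/

section Forms

variable {N : ℕ}

lemma integrable_snd_mul_sub {f g : E N → ℝ} (hf : Integrable f) (hg : Integrable g) :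
    Integrable (fun p : E N × E N => f p.2 * g (p.1 - p.2)) (volume.prod volume) :=
  hf.convolution_integrand (ContinuousLinearMap.mul ℝ ℝ) hg

lemma integrable_fst_mul_sub {f g : E N → ℝ} (hf : Integrable f) (hg : Integrable g) :
    Integrable (fun p : E N × E N => f p.1 * g (p.1 - p.2)) (volume.prod volume) := by
  refine ((integrable_snd_mul_sub hf hg.comp_neg).swap).congr (Eventually.of_forall fun p => ?_)
  simp

lemma integral_fst_mul_sub {f g : E N → ℝ} (hf : Integrable f) (hg : Integrable g) :
    ∫ p : E N × E N, f p.1 * g (p.1 - p.2) ∂(volume.prod volume) = (∫ x, f x) * ∫ z, g z := by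
  rw [integral_prod _ (integrable_fst_mul_sub hf hg)]
  simp only [integral_const_mul, integral_sub_left_eq_self g, integral_mul_const]

lemma integral_swap_eq (F : E N × E N → ℝ) :
    ∫ p, F p.swap ∂((volume : Measure (E N)).prod volume) = ∫ p, F p ∂(volume.prod volume) :=
  integral_prod_swap F

lemma measurable_kKer_sub : Measurable (fun p : E N × E N => kKer N (p.1 - p.2)) :=
  measurable_kKer.comp measurable_sub

lemma measurable_jKer_sub : Measurable (fun p : E N × E N => jKer N (p.1 - p.2)) :=
  measurable_jKer.comp measurable_sub

lemma aestronglyMeasurable_fst_sub_snd {u : E N → ℝ} (hu : AEStronglyMeasurable u) :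
    AEStronglyMeasurable (fun p : E N × E N => u p.1 - u p.2) (volume.prod volume) :=
  hu.comp_fst.sub hu.comp_snd

variable [NeZero N]

lemma integrable_energy {u v : E N → ℝ} (hu : MemH u) (hv : MemH v) :
    Integrable (fun p : E N × E N => (u p.1 - u p.2) * (v p.1 - v p.2) * kKer N (p.1 - p.2))
      (volume.prod volume) := by
  refine (hu.energy.add hv.energy).mono'
    (((aestronglyMeasurable_fst_sub_snd hu.memLp.1).mul
      (aestronglyMeasurable_fst_sub_snd hv.memLp.1)).mul
      measurable_kKer_sub.aestronglyMeasurable) (Eventually.of_forall fun p => ?_)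
  have hk := kKer_nonneg (p.1 - p.2)
  rw [Real.norm_eq_abs, abs_mul, abs_of_nonneg hk, Pi.add_apply, ← add_mul]
  gcongr
  rw [abs_le]
  constructor <;> nlinarith [sq_nonneg ((u p.1 - u p.2) + (v p.1 - v p.2)),
    sq_nonneg ((u p.1 - u p.2) - (v p.1 - v p.2)), sq_nonneg (u p.1 - u p.2),
    sq_nonneg (v p.1 - v p.2)]

/-- Young's inequality separates `|u| j ≤ u² + j²`; with the weight `|v|` both terms are integrable.
-/
lemma integrable_far {u v : E N → ℝ} (hu : MemLp u 2) (hv : Integrable v) :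
    Integrable (fun p : E N × E N => u p.1 * v p.2 * jKer N (p.1 - p.2))
      (volume.prod volume) := by
  have h1 : Integrable (fun p : E N × E N => u p.1 ^ 2 * |v p.2|) (volume.prod volume) :=
    hu.integrable_sq.mul_prod hv.abs
  have h2 := integrable_snd_mul_sub hv.abs (integrable_jKer_sq (N := N))
  refine (h1.add h2).mono' ((hu.1.comp_fst.mul hv.1.comp_snd).mul
    measurable_jKer_sub.aestronglyMeasurable) (Eventually.of_forall fun p => ?_)
  have hk := jKer_nonneg (p.1 - p.2)
  rw [Real.norm_eq_abs, abs_mul, abs_mul, abs_of_nonneg hk, Pi.add_apply, mul_comm (u p.1 ^ 2),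
    ← mul_add, mul_comm |u p.1|, mul_assoc]
  gcongr
  nlinarith [sq_nonneg (|u p.1| - jKer N (p.1 - p.2)), sq_abs (u p.1), sq_nonneg (u p.1),
    sq_nonneg (jKer N (p.1 - p.2))]

lemma MemH.sub_const_mul {u v : E N → ℝ} (hu : MemH u) (hv : MemH v) (ε : ℝ) :
    MemH (fun x => u x - ε * v x) where
  memLp := hu.memLp.sub (hv.memLp.const_mul ε)
  energy := by
    refine ((hu.energy.sub ((integrable_energy hu hv).const_mul (2 * ε))).add
      (hv.energy.const_mul (ε ^ 2))).congr (Eventually.of_forall fun p => ?_)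
    simp only [Pi.add_apply, Pi.sub_apply]
    ring

lemma logForm_sub_const_mul {u φ v : E N → ℝ} (hu : MemH u) (hφ : MemH φ) (hv : MemH v)
    (hv1 : Integrable v) (ε : ℝ) :
    logForm (fun x => u x - ε * φ x) v = logForm u v - ε * logForm φ v := by
  have e1 : energyForm (fun x => u x - ε * φ x) v = energyForm u v - ε * energyForm φ v := by
    rw [energyForm, energyForm, energyForm, mul_left_comm, ← mul_sub,
      ← integral_const_mul ε, ← integral_sub (integrable_energy hu hv)
        ((integrable_energy hφ hv).const_mul ε)]
    congr 2; ext p; ring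
  have e2 : ∫ p : E N × E N, (u p.1 - ε * φ p.1) * v p.2 * jKer N (p.1 - p.2)
      ∂(volume.prod volume) = (∫ p : E N × E N, u p.1 * v p.2 * jKer N (p.1 - p.2)
      ∂(volume.prod volume)) - ε * ∫ p : E N × E N, φ p.1 * v p.2 * jKer N (p.1 - p.2)
      ∂(volume.prod volume) := by
    rw [← integral_const_mul, ← integral_sub (integrable_far hu.memLp hv1)
        ((integrable_far hφ.memLp hv1).const_mul ε)]
    congr 1; ext p; ring
  have e3 : ∫ x, (u x - ε * φ x) * v x = (∫ x, u x * v x) - ε * ∫ x, φ x * v x := by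
    have h1 : Integrable (fun x => u x * v x) := hu.memLp.integrable_mul hv.memLp
    have h2 : Integrable (fun x => φ x * v x) := hφ.memLp.integrable_mul hv.memLp
    rw [← integral_const_mul, ← integral_sub h1 (h2.const_mul ε)]
    congr 1; ext p; ring
  rw [logForm, e1, e2, e3, logForm, logForm]
  ring

end Forms

/-! ### Lipschitz functions: finite energy and integration by parts. -/

section Lipschitz

variable {N : ℕ} {φ : E N → ℝ} {L : ℝ}

lemma exists_lipschitz_bound (hφ : ContDiff ℝ ∞ φ) (hc : HasCompactSupport φ) :
    ∃ L : ℝ, 0 ≤ L ∧ ∀ x y, |φ x - φ y| ≤ L * ‖x - y‖ := by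
  obtain ⟨C, hC⟩ := ContDiff.lipschitzWith_of_hasCompactSupport hc hφ (by simp)
  exact ⟨C, C.2, fun x y => by simpa [Real.dist_eq, dist_eq_norm] using hC.dist_le_mul x y⟩

variable [NeZero N]

lemma integrable_near_of_lipschitz (hφ : Continuous φ) (hL : ∀ x y, |φ x - φ y| ≤ L * ‖x - y‖)
    {v : E N → ℝ} (hv : Integrable v) :
    Integrable (fun p : E N × E N => (φ p.1 - φ p.2) * v p.1 * kKer N (p.1 - p.2))
      (volume.prod volume) := by
  refine ((integrable_fst_mul_sub hv.abs (integrable_norm_mul_kKer (N := N))).const_mul L).mono'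
    (((aestronglyMeasurable_fst_sub_snd hφ.aestronglyMeasurable).mul hv.1.comp_fst).mul
      measurable_kKer_sub.aestronglyMeasurable) (Eventually.of_forall fun p => ?_)
  have hk := kKer_nonneg (p.1 - p.2)
  rw [Real.norm_eq_abs, abs_mul, abs_mul, abs_of_nonneg hk]
  calc _ ≤ (L * ‖p.1 - p.2‖) * |v p.1| * kKer N (p.1 - p.2) := by gcongr; exact hL _ _
    _ = _ := by ring

lemma memH_of_lipschitz (hφ : Continuous φ) (hc : HasCompactSupport φ)
    (hL : ∀ x y, |φ x - φ y| ≤ L * ‖x - y‖) : MemH φ where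
  memLp := hφ.memLp_of_hasCompactSupport hc
  energy := by
    have hS : Integrable ((tsupport φ).indicator (fun _ : E N => (1 : ℝ))) :=
      (integrable_indicator_iff hc.isCompact.measurableSet).2 (by simp [hc.isCompact.measure_lt_top])
    refine (((integrable_fst_mul_sub hS (integrable_norm_sq_mul_kKer (N := N))).add
      (integrable_snd_mul_sub hS (integrable_norm_sq_mul_kKer (N := N)))).const_mul (L ^ 2)).mono'
      (((aestronglyMeasurable_fst_sub_snd hφ.aestronglyMeasurable).pow 2).mul
        measurable_kKer_sub.aestronglyMeasurable) (Eventually.of_forall fun p => ?_)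
    have hk := kKer_nonneg (p.1 - p.2)
    rw [Real.norm_of_nonneg (by positivity), Pi.add_apply, ← add_mul]
    have h1 : (φ p.1 - φ p.2) ^ 2 ≤ (L * ‖p.1 - p.2‖) ^ 2 := by
      rw [← sq_abs]; gcongr; exact hL _ _
    have hi : ∀ x, 0 ≤ (tsupport φ).indicator (fun _ : E N => (1 : ℝ)) x :=
      fun x => indicator_nonneg (fun _ _ => zero_le_one) x
    by_cases h : p.1 ∉ tsupport φ ∧ p.2 ∉ tsupport φ
    · rw [image_eq_zero_of_notMem_tsupport h.1, image_eq_zero_of_notMem_tsupport h.2]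
      simp only [sub_self, ne_eq, OfNat.ofNat_ne_zero, not_false_eq_true, zero_pow, zero_mul]
      have := hi p.1; have := hi p.2
      positivity
    · have h2 : 1 ≤ (tsupport φ).indicator (fun _ : E N => (1 : ℝ)) p.1 +
          (tsupport φ).indicator (fun _ : E N => (1 : ℝ)) p.2 := by
        rw [not_and_or, not_not, not_not] at h
        rcases h with h | h
        · rw [indicator_of_mem h]; linarith [hi p.2]
        · rw [indicator_of_mem h]; linarith [hi p.1]
      calc _ ≤ (L * ‖p.1 - p.2‖) ^ 2 * kKer N (p.1 - p.2) := by gcongr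
        _ = L ^ 2 * (1 * (‖p.1 - p.2‖ ^ 2 * kKer N (p.1 - p.2))) := by ring
        _ ≤ _ := by gcongr

omit [NeZero N] in
lemma logLaplacian_eq (x : E N) : logLaplacian φ x =
    (∫ y, ((φ x - φ y) * kKer N (x - y) - φ y * jKer N (x - y))) + rhoConst N * φ x := by
  rw [logLaplacian, ← integral_const_mul]
  congr 2; ext y
  simp only [indicator, mem_ball, kKer_eq, jKer_eq, dist_comm y x, dist_eq_norm]
  split_ifs <;> ring

/-- The Lipschitz bound cancels one power of the singularity, so `(φ(x) - φ(y)) v(x) k(x - y)` is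
integrable by itself. The energy integrand is the sum of this function and its swap, and no energy
bound on `v` is needed. -/
lemma logForm_eq_integral_logLaplacian (hφ : Continuous φ) (hc : HasCompactSupport φ)
    (hL : ∀ x y, |φ x - φ y| ≤ L * ‖x - y‖) {v : E N → ℝ} (hv1 : Integrable v)
    (hv2 : MemLp v 2) :
    Integrable (fun x => logLaplacian φ x * v x) ∧
      logForm φ v = ∫ x, logLaplacian φ x * v x := by
  have hφ2 : MemLp φ 2 := hφ.memLp_of_hasCompactSupport hc
  have hA := integrable_near_of_lipschitz hφ hL hv1
  have hJ := integrable_far hφ2 hv1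
  have hJ' : Integrable (fun p : E N × E N => φ p.2 * v p.1 * jKer N (p.1 - p.2))
      (volume.prod volume) :=
    hJ.swap.congr (Eventually.of_forall fun p => by
      simp only [Function.comp, Prod.swap, jKer_sub_comm p.2 p.1])
  have h1 : energyForm φ v =
      ∫ p : E N × E N, (φ p.1 - φ p.2) * v p.1 * kKer N (p.1 - p.2) ∂(volume.prod volume) := by
    have : ∀ p : E N × E N, (φ p.1 - φ p.2) * (v p.1 - v p.2) * kKer N (p.1 - p.2) =
        (φ p.1 - φ p.2) * v p.1 * kKer N (p.1 - p.2) +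
        (fun p : E N × E N => (φ p.1 - φ p.2) * v p.1 * kKer N (p.1 - p.2)) p.swap := by
      intro p
      simp only [Prod.fst_swap, Prod.snd_swap, kKer_sub_comm p.2 p.1]
      ring
    rw [energyForm, integral_congr_ae (Eventually.of_forall this),
      integral_add (g := fun p : E N × E N =>
        (fun p : E N × E N => (φ p.1 - φ p.2) * v p.1 * kKer N (p.1 - p.2)) p.swap) hA hA.swap,
      integral_swap_eq (fun p : E N × E N => (φ p.1 - φ p.2) * v p.1 * kKer N (p.1 - p.2))]
    ring
  have h2 : ∫ p : E N × E N, φ p.1 * v p.2 * jKer N (p.1 - p.2) ∂(volume.prod volume) =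
      ∫ p : E N × E N, φ p.2 * v p.1 * jKer N (p.1 - p.2) ∂(volume.prod volume) := by
    rw [← integral_swap_eq]
    congr 1; ext p
    simp only [Prod.fst_swap, Prod.snd_swap, jKer_sub_comm p.2 p.1]
  have h3 : ∀ x, logLaplacian φ x * v x =
      (∫ y, ((φ x - φ y) * v x * kKer N (x - y) - φ y * v x * jKer N (x - y))) +
        rhoConst N * (φ x * v x) := by
    intro x
    rw [logLaplacian_eq, add_mul, ← integral_mul_const]
    congr 1
    · congr 1; ext y; ring
    · ring
  have hAJ : Integrable (fun p : E N × E N => (φ p.1 - φ p.2) * v p.1 * kKer N (p.1 - p.2) -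
      φ p.2 * v p.1 * jKer N (p.1 - p.2)) (volume.prod volume) := hA.sub hJ'
  have hI := hAJ.integral_prod_left
  have hφv : Integrable (fun x => rhoConst N * (φ x * v x)) :=
    (hφ2.integrable_mul hv2).const_mul _
  refine ⟨(hI.add hφv).congr (Eventually.of_forall fun x => (h3 x).symm), ?_⟩
  rw [integral_congr_ae (Eventually.of_forall h3), logForm, h1, h2, ← integral_sub hA hJ',
    integral_prod _ hAJ, integral_add hI hφv, integral_const_mul]

end Lipschitz

/-! ### The antisymmetric negative part as a test function, and coercivity on small balls. -/

section MaximumPrinciple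

variable {N : ℕ} [NeZero N] {w : E N → ℝ}

/-- The negative part of `w` in the half-space, extended by zero. -/
def negPartHalf (w : E N → ℝ) : E N → ℝ := (halfSpace N).indicator (fun x => max (-w x) 0)

lemma negPartHalf_of_pos {x : E N} (hx : 0 < x 0) : negPartHalf w x = max (-w x) 0 :=
  indicator_of_mem (s := halfSpace N) hx _

lemma negPartHalf_of_nonpos {x : E N} (hx : x 0 ≤ 0) : negPartHalf w x = 0 :=
  indicator_of_notMem (s := halfSpace N) (not_lt.2 hx) _

lemma negPartHalf_nonneg (x : E N) : 0 ≤ negPartHalf w x :=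
  indicator_nonneg (fun _ _ => le_max_right _ _) x

lemma abs_negPartHalf_le (x : E N) : |negPartHalf w x| ≤ |w x| := by
  rw [abs_of_nonneg (negPartHalf_nonneg x)]
  rcases lt_or_ge 0 (x 0) with h | h
  · rw [negPartHalf_of_pos h]
    exact max_le (neg_le_abs _) (abs_nonneg _)
  · rw [negPartHalf_of_nonpos h]; exact abs_nonneg _

lemma add_negPartHalf_mul (x : E N) : (w x + negPartHalf w x) * negPartHalf w x = 0 := by
  rcases lt_or_ge 0 (x 0) with h | h
  · rw [negPartHalf_of_pos h]
    rcases le_total (-w x) 0 with h1 | h1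
    · rw [max_eq_right h1, mul_zero]
    · rw [max_eq_left h1]; ring
  · rw [negPartHalf_of_nonpos h, mul_zero]

lemma aestronglyMeasurable_negPartHalf (hw : AEStronglyMeasurable w) :
    AEStronglyMeasurable (negPartHalf w) :=
  (hw.neg.sup aestronglyMeasurable_const).indicator isOpen_halfSpace.measurableSet

lemma memLp_negPartHalf (hw : MemLp w 2) : MemLp (negPartHalf w) 2 :=
  hw.mono (aestronglyMeasurable_negPartHalf hw.1)
    (Eventually.of_forall fun x => abs_negPartHalf_le x)

lemma measurePreserving_prod_hyperRefl_snd :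
    MeasurePreserving (fun p : E N × E N => (p.1, hyperRefl N p.2)) (volume.prod volume)
      (volume.prod volume) :=
  (MeasurePreserving.id _).prod measurePreserving_hyperRefl

lemma measurePreserving_prod_hyperRefl_fst :
    MeasurePreserving (fun p : E N × E N => (hyperRefl N p.1, p.2)) (volume.prod volume)
      (volume.prod volume) :=
  measurePreserving_hyperRefl.prod (MeasurePreserving.id _)

lemma norm_sub_hyperRefl_le {x y : E N} (h : x 0 * y 0 ≤ 0) :
    ‖x - hyperRefl N y‖ ≤ ‖x - y‖ :=
  le_of_sq_le_sq (by rw [norm_sub_hyperRefl_sq]; linarith) (norm_nonneg _)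

lemma norm_sub_le_hyperRefl {x y : E N} (h : 0 ≤ x 0 * y 0) :
    ‖x - y‖ ≤ ‖x - hyperRefl N y‖ :=
  le_of_sq_le_sq (by rw [norm_sub_hyperRefl_sq]; linarith) (norm_nonneg _)

/-- For points on opposite sides, `(w x - w y)² + (w x + w y)² = 2 (w x)² + 2 (w y)²` controls `a²`,
and the mirror image of `y` is closer to `x`, so its kernel value is the larger one. -/
lemma sq_mul_kKer_le {x y : E N} (hxy : x 0 * y 0 ≤ 0) (hwy : w (hyperRefl N y) = -w y) {a : ℝ}
    (ha : a ^ 2 ≤ w x ^ 2 ∨ a ^ 2 ≤ w y ^ 2) :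
    a ^ 2 * kKer N (x - y) ≤ (w x - w y) ^ 2 * kKer N (x - y) +
      (w x - w (hyperRefl N y)) ^ 2 * kKer N (x - hyperRefl N y) := by
  have hk := kKer_nonneg (x - y)
  -- At the mirror point the reflected kernel takes the value 0, so monotonicity fails; there `w x -
  -- w y = -2 w y` suffices.
  by_cases h0 : x - hyperRefl N y = 0
  · have hwx : w x = -w y := by rw [sub_eq_zero.1 h0, hwy]
    have h1 : a ^ 2 ≤ (w x - w y) ^ 2 := by
      rw [hwx] at ha ⊢
      rcases ha with h | h <;> nlinarith [sq_nonneg (w y)]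
    have h2 : 0 ≤ (w x - w (hyperRefl N y)) ^ 2 * kKer N (x - hyperRefl N y) :=
      mul_nonneg (sq_nonneg _) (kKer_nonneg _)
    exact (mul_le_mul_of_nonneg_right h1 hk).trans (le_add_of_nonneg_right h2)
  · have hk' := kKer_anti h0 (norm_sub_hyperRefl_le hxy)
    have h1 : a ^ 2 ≤ (w x - w y) ^ 2 + (w x + w y) ^ 2 := by
      rcases ha with h | h <;> nlinarith [sq_nonneg (w y), sq_nonneg (w x)]
    calc a ^ 2 * kKer N (x - y) ≤ ((w x - w y) ^ 2 + (w x + w y) ^ 2) * kKer N (x - y) := by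
          gcongr
      _ = (w x - w y) ^ 2 * kKer N (x - y) + (w x + w y) ^ 2 * kKer N (x - y) := by ring
      _ ≤ _ := by rw [hwy, sub_neg_eq_add]; gcongr

/-- Cutting off at the hyperplane could create energy across it; antisymmetry pays for it with the
reflected energy density of `w`. On one side, taking the negative part is 1-Lipschitz. -/
lemma sq_negPartHalf_sub_le {x y : E N} (hwy : w (hyperRefl N y) = -w y) :
    (negPartHalf w x - negPartHalf w y) ^ 2 * kKer N (x - y) ≤
      (w x - w y) ^ 2 * kKer N (x - y) +
      (w x - w (hyperRefl N y)) ^ 2 * kKer N (x - hyperRefl N y) := by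
  have hk := kKer_nonneg (x - y)
  have hk' := kKer_nonneg (x - hyperRefl N y)
  rcases lt_or_ge 0 (x 0) with hx | hx <;> rcases lt_or_ge 0 (y 0) with hy | hy
  · have h1 : (negPartHalf w x - negPartHalf w y) ^ 2 ≤ (w x - w y) ^ 2 := by
      rw [negPartHalf_of_pos hx, negPartHalf_of_pos hy, sq_le_sq]
      refine (abs_max_sub_max_le_abs _ _ _).trans_eq ?_
      rw [neg_sub_neg, abs_sub_comm]
    have h2 : 0 ≤ (w x - w (hyperRefl N y)) ^ 2 * kKer N (x - hyperRefl N y) := by positivity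
    exact (mul_le_mul_of_nonneg_right h1 hk).trans (le_add_of_nonneg_right h2)
  · rw [negPartHalf_of_nonpos hy, sub_zero]
    exact sq_mul_kKer_le (mul_nonpos_of_nonneg_of_nonpos hx.le hy) hwy
      (Or.inl (sq_le_sq.2 (abs_negPartHalf_le x)))
  · rw [negPartHalf_of_nonpos hx, zero_sub, neg_sq]
    exact sq_mul_kKer_le (mul_nonpos_of_nonpos_of_nonneg hx hy.le) hwy
      (Or.inr (sq_le_sq.2 (abs_negPartHalf_le y)))
  · rw [negPartHalf_of_nonpos hx, negPartHalf_of_nonpos hy]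
    simp only [sub_self, ne_eq, OfNat.ofNat_ne_zero, not_false_eq_true, zero_pow, zero_mul]
    positivity

lemma memH_negPartHalf (hw : MemH w) (ha : ∀ᵐ x, w (hyperRefl N x) = -w x) :
    MemH (negPartHalf w) where
  memLp := memLp_negPartHalf hw.memLp
  energy := by
    have h2 := measurePreserving_prod_hyperRefl_snd.integrable_comp_of_integrable hw.energy
    refine (hw.energy.add h2).mono' (((aestronglyMeasurable_fst_sub_snd
      (aestronglyMeasurable_negPartHalf hw.memLp.1)).pow 2).mul
      measurable_kKer_sub.aestronglyMeasurable) ?_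
    filter_upwards [Measure.quasiMeasurePreserving_snd.ae ha] with p hp
    have hk := kKer_nonneg (p.1 - p.2)
    rw [Real.norm_of_nonneg (by positivity)]
    exact sq_negPartHalf_sub_le hp

lemma kernel_le_of_norm_le {z z' : E N} (h0 : z ≠ 0) (h : ‖z‖ ≤ ‖z'‖) :
    kKer N z' + jKer N z' ≤ kKer N z + jKer N z := by
  rw [kKer_add_jKer, kKer_add_jKer]
  have := (cConst_pos (N := N)).le
  have hz : 0 < ‖z‖ := norm_pos_iff.2 h0
  gcongr

/-- For `x` in `H⁺`, `w + v` is the positive part of `w` at `x` and `-w x` at the mirror point. If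
`w x ≥ 0`, the direct kernel beats the reflected one; if `w x < 0`, only a nonnegative reflected
term survives. -/
lemma reflected_sum_nonneg_of_pos {x y : E N} (hx : 0 < x 0)
    (hwx : w (hyperRefl N x) = -w x) :
    0 ≤ (w x + negPartHalf w x) * negPartHalf w y * (kKer N (x - y) + jKer N (x - y)) +
      (w (hyperRefl N x) + negPartHalf w (hyperRefl N x)) * negPartHalf w y *
        (kKer N (hyperRefl N x - y) + jKer N (hyperRefl N x - y)) := by
  have hv := negPartHalf_nonneg (w := w) y
  have hk1 := add_nonneg (kKer_nonneg (x - y)) (jKer_nonneg (x - y))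
  have hk2 := add_nonneg (kKer_nonneg (hyperRefl N x - y)) (jKer_nonneg (hyperRefl N x - y))
  rw [negPartHalf_of_pos hx, negPartHalf_of_nonpos (x := hyperRefl N x)
    (by rw [hyperRefl_coord]; linarith), hwx, add_zero]
  rcases le_or_gt 0 (w x) with h | h
  · rw [max_eq_right (by linarith), add_zero]
    rcases lt_or_ge 0 (y 0) with hy | hy
    -- The kernel comparison fails on the diagonal, but there `v y = 0`.
    · by_cases hxy : x - y = 0
      · rw [← sub_eq_zero.1 hxy, negPartHalf_of_pos hx, max_eq_right (by linarith)]
        simp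
      · have := kernel_le_of_norm_le hxy (z' := hyperRefl N x - y)
          (by rw [norm_hyperRefl_sub]; exact norm_sub_le_hyperRefl (mul_pos hx hy).le)
        have := mul_nonneg (mul_nonneg h hv) (sub_nonneg.2 this)
        linarith
    · rw [negPartHalf_of_nonpos hy]; simp
  · rw [max_eq_left (by linarith), add_neg_cancel, zero_mul, zero_mul, zero_add]
    exact mul_nonneg (mul_nonneg (by linarith) hv) hk2

lemma reflected_sum_nonneg {x y : E N} (hwx : w (hyperRefl N x) = -w x) :
    0 ≤ (w x + negPartHalf w x) * negPartHalf w y * (kKer N (x - y) + jKer N (x - y)) +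
      (w (hyperRefl N x) + negPartHalf w (hyperRefl N x)) * negPartHalf w y *
        (kKer N (hyperRefl N x - y) + jKer N (hyperRefl N x - y)) := by
  rcases lt_trichotomy 0 (x 0) with hx | hx | hx
  · exact reflected_sum_nonneg_of_pos hx hwx
  · have h1 : hyperRefl N x = x := by rw [hyperRefl_apply, ← hx]; simp
    have h2 : w x = 0 := by rw [h1] at hwx; linarith
    rw [h1, h2, negPartHalf_of_nonpos hx.ge]
    simp
  · have := reflected_sum_nonneg_of_pos (w := w) (x := hyperRefl N x) (y := y)
      (by rw [hyperRefl_coord]; linarith) (by rw [hyperRefl_hyperRefl, hwx, neg_neg])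
    rw [hyperRefl_hyperRefl] at this
    linarith

/-- There is no cancellation between the product and its swap: inside `H⁺` both are nonnegative,
otherwise one vanishes. Hence integrability of the symmetrized integrand passes to each half. -/
lemma abs_add_negPartHalf_mul_le (x y : E N) :
    |(w x + negPartHalf w x) * negPartHalf w y| ≤
      |(w x + negPartHalf w x) * negPartHalf w y + (w y + negPartHalf w y) * negPartHalf w x| := by
  rcases lt_or_ge 0 (x 0) with hx | hx
  · rcases lt_or_ge 0 (y 0) with hy | hy
    · have hv : ∀ z : E N, 0 < z 0 → 0 ≤ w z + negPartHalf w z := fun z hz => by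
        rw [negPartHalf_of_pos hz]; linarith [le_max_left (-w z) 0]
      have h1 := mul_nonneg (hv x hx) (negPartHalf_nonneg (w := w) y)
      have h2 := mul_nonneg (hv y hy) (negPartHalf_nonneg (w := w) x)
      rw [abs_of_nonneg h1, abs_of_nonneg (add_nonneg h1 h2)]
      linarith
    · rw [negPartHalf_of_nonpos hy, mul_zero, abs_zero]; exact abs_nonneg _
  · rw [negPartHalf_of_nonpos hx]; simp

/-- Testing an antisymmetric function with its negative part in the half-space. -/
lemma logForm_negPartHalf_le (hw : MemH w) (ha : ∀ᵐ x, w (hyperRefl N x) = -w x)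
    (hv1 : Integrable (negPartHalf w)) :
    logForm w (negPartHalf w) ≤ -logForm (negPartHalf w) (negPartHalf w) := by
  set v := negPartHalf w with hvdef
  have hv : MemH v := memH_negPartHalf hw ha
  set G : E N × E N → ℝ := fun p => (w p.1 + v p.1) * v p.2 * kKer N (p.1 - p.2) with hG
  set J : E N × E N → ℝ := fun p => (w p.1 + v p.1) * v p.2 * jKer N (p.1 - p.2) with hJ
  have hJw := integrable_far hw.memLp hv1
  have hJv := integrable_far hv.memLp hv1
  have hJi : Integrable J (volume.prod volume) :=
    (hJw.add hJv).congr (Eventually.of_forall fun p => by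
      simp only [hJ, Pi.add_apply]; ring)
  have hEw := integrable_energy hw hv
  have hEv := integrable_energy hv hv
  -- The diagonal products drop out because `(w + v) v = 0`.
  have hsum : ∀ p : E N × E N, (w p.1 - w p.2) * (v p.1 - v p.2) * kKer N (p.1 - p.2) +
      (v p.1 - v p.2) * (v p.1 - v p.2) * kKer N (p.1 - p.2) = -(G p + G p.swap) := by
    intro p
    have h1 := add_negPartHalf_mul (w := w) p.1
    have h2 := add_negPartHalf_mul (w := w) p.2
    simp only [hG, Prod.fst_swap, Prod.snd_swap, kKer_sub_comm p.2 p.1]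
    linear_combination kKer N (p.1 - p.2) * (h1 + h2)
  have hGi : Integrable G (volume.prod volume) := by
    refine (hEw.add hEv).mono (((hw.memLp.1.comp_fst.add hv.memLp.1.comp_fst).mul
      hv.memLp.1.comp_snd).mul measurable_kKer_sub.aestronglyMeasurable)
      (Eventually.of_forall fun p => ?_)
    rw [Pi.add_apply, hsum]
    simp only [hG, Prod.fst_swap, Prod.snd_swap, kKer_sub_comm p.2 p.1, ← add_mul, norm_neg,
      norm_mul, Real.norm_eq_abs]
    rw [← abs_mul]
    exact mul_le_mul_of_nonneg_right (abs_add_negPartHalf_mul_le p.1 p.2) (abs_nonneg _)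
  have hE : energyForm w v + energyForm v v = -∫ p, G p ∂(volume.prod volume) := by
    rw [energyForm, energyForm, ← mul_add, ← integral_add hEw hEv,
      integral_congr_ae (Eventually.of_forall hsum), integral_neg,
      integral_add (g := fun p : E N × E N => G p.swap) hGi hGi.swap, integral_swap_eq]
    ring
  have hJe : (∫ p : E N × E N, w p.1 * v p.2 * jKer N (p.1 - p.2) ∂(volume.prod volume)) +
      (∫ p : E N × E N, v p.1 * v p.2 * jKer N (p.1 - p.2) ∂(volume.prod volume)) =
      ∫ p, J p ∂(volume.prod volume) := by
    rw [← integral_add hJw hJv]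
    congr 1; ext p; simp only [hJ]; ring
  have h0 : (∫ x, w x * v x) + ∫ x, v x * v x = 0 := by
    have i1 : Integrable (fun x => w x * v x) := hw.memLp.integrable_mul hv.memLp
    have i2 : Integrable (fun x => v x * v x) := hv.memLp.integrable_mul hv.memLp
    rw [← integral_add i1 i2]
    refine integral_eq_zero_of_ae (Eventually.of_forall fun x => ?_)
    have := add_negPartHalf_mul (w := w) x
    simp only [Pi.zero_apply]; linarith
  -- The integrand `K` has no pointwise sign; its sum with its reflection in the first variable is
  -- nonnegative and has twice the integral.
  have hpos : 0 ≤ (∫ p, G p ∂(volume.prod volume)) + ∫ p, J p ∂(volume.prod volume) := by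
    set K : E N × E N → ℝ := fun p => G p + J p with hK
    have hKi : Integrable K (volume.prod volume) := hGi.add hJi
    have hmp := measurePreserving_prod_hyperRefl_fst (N := N)
    have hKr : Integrable (fun p : E N × E N => K (hyperRefl N p.1, p.2))
      (volume.prod volume) := hmp.integrable_comp_of_integrable hKi
    have hKe : ∫ p : E N × E N, K (hyperRefl N p.1, p.2) ∂(volume.prod volume) =
        ∫ p, K p ∂(volume.prod volume) :=
      hmp.integral_comp ((hyperRefl N).toHomeomorph.prodCongr
        (Homeomorph.refl _)).measurableEmbedding K
    have h2 : 0 ≤ ∫ p : E N × E N, (K p + K (hyperRefl N p.1, p.2)) ∂(volume.prod volume) := by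
      refine integral_nonneg_of_ae ?_
      filter_upwards [Measure.quasiMeasurePreserving_fst.ae ha] with p hp
      have := reflected_sum_nonneg (w := w) (y := p.2) hp
      simp only [Pi.zero_apply, hK, hG, hJ]
      linarith
    rw [integral_add hKi hKr, hKe] at h2
    rw [← integral_add hGi hJi]
    linarith
  rw [logForm, logForm]
  linear_combination hpos + hE - hJe + rhoConst N * h0

/-- A Poincaré inequality for functions supported in a small ball. -/
lemma le_logForm_of_small_support {v : E N → ℝ} (hv : MemH v) {s : ℝ} (hs : 0 < s)
    (hs1 : 2 * s ≤ 1) (hsupp : ∀ᵐ x, x ∉ ball (0 : E N) s → v x = 0) :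
    ((∫ z, truncKer N (2 * s) z) + rhoConst N) * ∫ x, v x ^ 2 ≤ logForm v v := by
  have hfst := Measure.quasiMeasurePreserving_fst (μ := (volume : Measure (E N)))
    (ν := (volume : Measure (E N))) |>.ae hsupp
  have hsnd := Measure.quasiMeasurePreserving_snd (μ := (volume : Measure (E N)))
    (ν := (volume : Measure (E N))) |>.ae hsupp
  have hdist : ∀ x y : E N, x ∈ ball (0 : E N) s → y ∈ ball (0 : E N) s → ‖x - y‖ < 2 * s := by
    intro x y hx hy
    rw [mem_ball_zero_iff] at hx hy
    linarith [norm_sub_le x y]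
  have hJ : ∫ p : E N × E N, v p.1 * v p.2 * jKer N (p.1 - p.2) ∂(volume.prod volume) = 0 := by
    refine integral_eq_zero_of_ae ?_
    filter_upwards [hfst, hsnd] with p h1 h2
    by_cases hx : p.1 ∈ ball (0 : E N) s
    · by_cases hy : p.2 ∈ ball (0 : E N) s
      · rw [jKer_eq, if_pos ((hdist _ _ hx hy).trans_le hs1)]; simp
      · simp [h2 hy]
    · simp [h1 hx]
  have ht := integrable_truncKer (N := N) (a := 2 * s) (by positivity)
  have hsq := hv.memLp.integrable_sq
  have h1 := integrable_fst_mul_sub hsq ht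
  have htc : ∀ p : E N × E N, truncKer N (2 * s) (p.2 - p.1) = truncKer N (2 * s) (p.1 - p.2) := by
    intro p
    rw [truncKer_eq, truncKer_eq, norm_sub_rev, kKer_sub_comm]
  have h2 : ∫ p : E N × E N, v p.2 ^ 2 * truncKer N (2 * s) (p.1 - p.2) ∂(volume.prod volume) =
      (∫ x, v x ^ 2) * ∫ z, truncKer N (2 * s) z := by
    rw [← integral_fst_mul_sub hsq ht, ← integral_swap_eq]
    congr 1; ext p
    simp only [Prod.fst_swap, Prod.snd_swap, htc]
  have hE : (∫ x, v x ^ 2) * ∫ z, truncKer N (2 * s) z ≤ energyForm v v := by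
    have h3 : ∫ p : E N × E N, (v p.1 ^ 2 * truncKer N (2 * s) (p.1 - p.2) +
        v p.2 ^ 2 * truncKer N (2 * s) (p.1 - p.2)) ∂(volume.prod volume) ≤
        ∫ p : E N × E N, (v p.1 - v p.2) * (v p.1 - v p.2) * kKer N (p.1 - p.2)
          ∂(volume.prod volume) := by
      refine integral_mono_ae (h1.add (integrable_snd_mul_sub hsq ht)) (integrable_energy hv hv) ?_
      filter_upwards [hfst, hsnd] with p h1 h2
      have hk := kKer_nonneg (p.1 - p.2)
      have hle := truncKer_le (2 * s) (p.1 - p.2)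
      -- If both points lie in the ball, the truncated kernel vanishes; otherwise one value of `v`
      -- is 0 and the squared difference equals the sum of squares.
      by_cases hx : p.1 ∈ ball (0 : E N) s
      · by_cases hy : p.2 ∈ ball (0 : E N) s
        · simp only [truncKer_eq, if_pos (hdist _ _ hx hy), mul_zero, add_zero]
          exact mul_nonneg (mul_self_nonneg _) hk
        · simp only [h2 hy]
          nlinarith [mul_le_mul_of_nonneg_left hle (sq_nonneg (v p.1))]
      · simp only [h1 hx]
        nlinarith [mul_le_mul_of_nonneg_left hle (sq_nonneg (v p.2))]
    rw [integral_add h1 (integrable_snd_mul_sub hsq ht), integral_fst_mul_sub hsq ht, h2] at h3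
    rw [energyForm]
    linarith
  rw [logForm, hJ]
  have : ∫ x, v x * v x = ∫ x, v x ^ 2 := by simp only [sq]
  rw [this]
  linarith

end MaximumPrinciple

/-! ### Comparison with a barrier and the slope at the origin. -/

section Comparison

variable {N : ℕ} [NeZero N]

lemma halfBall_subset {ρ σ : ℝ} (h : ρ ≤ σ) : halfBall N ρ ⊆ halfBall N σ :=
  inter_subset_inter_left _ (ball_subset_ball h)

lemma closedBall_subset_halfBall {r : ℝ} (hr : 0 < r) :
    closedBall (r • e1 N) (r / 2) ⊆ halfBall N (2 * r) := by
  intro x hx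
  rw [mem_closedBall, dist_eq_norm] at hx
  constructor
  · rw [mem_ball_zero_iff]
    have h1 : ‖x‖ ≤ ‖x - r • e1 N‖ + ‖r • e1 N‖ := by
      simpa using norm_add_le (x - r • e1 N) (r • e1 N)
    rw [norm_smul, norm_e1, Real.norm_of_nonneg hr.le] at h1
    linarith
  · have h1 := (abs_coord_le_norm (x - r • e1 N)).trans hx
    simp only [PiLp.sub_apply, PiLp.smul_apply, e1_apply_zero, smul_eq_mul, mul_one] at h1
    have := (abs_le.1 h1).1
    change 0 < x 0
    linarith

lemma antisymmetric_iff {u : E N → ℝ} :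
    Antisymmetric (e1 N) u ↔ ∀ᵐ x, u (hyperRefl N x) = -u x := Iff.rfl

omit [NeZero N] in
lemma integrable_of_memLp_two {v : E N → ℝ} (hv : MemLp v 2) {s : ℝ}
    (hs : ∀ᵐ x, x ∉ ball (0 : E N) s → v x = 0) : Integrable v := by
  have : IsFiniteMeasure ((volume : Measure (E N)).restrict (ball 0 s)) :=
    ⟨by simp [measure_ball_lt_top]⟩
  have h : IntegrableOn v (ball (0 : E N) s) :=
    (hv.restrict (ball 0 s)).integrable one_le_two
  exact h.integrable_of_ae_notMem_eq_zero hs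

omit [NeZero N] in
lemma le_of_ae_le_of_isOpen {Ω : Set (E N)} (hΩ : IsOpen Ω) {f g : E N → ℝ}
    (hf : ContinuousOn f Ω) (hg : ContinuousOn g Ω) (h : ∀ᵐ x, x ∈ Ω → f x ≤ g x) :
    ∀ x ∈ Ω, f x ≤ g x := by
  intro x hx
  by_contra hlt
  have ho : IsOpen (Ω ∩ (fun y => f y - g y) ⁻¹' Ioi 0) :=
    (hf.sub hg).isOpen_inter_preimage hΩ isOpen_Ioi
  have hpos := ho.measure_pos volume ⟨x, hx, sub_pos.2 (not_le.1 hlt)⟩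
  refine hpos.ne' (measure_mono_null (fun y hy => ?_) h)
  exact fun hle => absurd (hle hy.1) (not_le.2 (sub_pos.1 hy.2))

lemma IsBarrier.memH {V : E N → ℝ} {r : ℝ} {φ : E N → ℝ} (h : IsBarrier V r φ) : MemH φ := by
  obtain ⟨L, -, hL⟩ := exists_lipschitz_bound h.smooth h.compactSupport
  exact memH_of_lipschitz h.smooth.continuous h.compactSupport hL

lemma IsBarrier.le_one_closedBall {V : E N → ℝ} {r : ℝ} (hr : 0 < r) {φ : E N → ℝ}
    (h : IsBarrier V r φ) : ∀ x ∈ closedBall (r • e1 N) (r / 2), φ x ≤ 1 := by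
  rw [← closure_ball _ (by positivity)]
  exact fun x hx => closure_minimal h.le_one (isClosed_le h.smooth.continuous continuous_const) hx

/-- Comparison with a barrier in a half-ball of small radius. -/
lemma IsBarrier.mul_le {R r M : ℝ} {u V φ : E N → ℝ}
    (hV : MemLp V ⊤ (volume.restrict (halfBall N R)))
    (hu : MemH u) (hcont : ContinuousOn u (halfBall N R)) (hanti : Antisymmetric (e1 N) u)
    (hsuper : IsWeakSupersolution (halfBall N R) (fun x => V x * u x) u)
    (hnonneg : ∀ᵐ x, x ∈ halfSpace N → 0 ≤ u x)
    (hM : ∀ᵐ x, x ∈ halfBall N R → |V x| ≤ M)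
    (hr : 0 < r) (hrR : 2 * r ≤ R) (hr4 : 2 * (2 * r) ≤ 1)
    (hT : M < (∫ z, truncKer N (2 * (2 * r)) z) + rhoConst N)
    (hφ : IsBarrier V r φ) {ε : ℝ} (hε : 0 < ε)
    (hεu : ∀ x ∈ closedBall (r • e1 N) (r / 2), ε ≤ u x) :
    ∀ x ∈ halfBall N (2 * r), ε * φ x ≤ u x := by
  have hsub := halfBall_subset (N := N) hrR
  set w : E N → ℝ := fun x => u x - ε * φ x with hwdef
  set v := negPartHalf w with hvdef
  have hφH := hφ.memH
  have hw : MemH w := hu.sub_const_mul hφH ε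
  have ha : ∀ᵐ x, w (hyperRefl N x) = -w x := by
    filter_upwards [antisymmetric_iff.1 hanti, antisymmetric_iff.1 hφ.antisymmetric] with x h1 h2
    simp only [hwdef, h1, h2]; ring
  have hvH : MemH v := memH_negPartHalf hw ha
  have hv0 : ∀ᵐ x, x ∉ halfBall N (2 * r) \ closedBall (r • e1 N) (r / 2) → v x = 0 := by
    filter_upwards [hnonneg] with x hx hxU
    rcases lt_or_ge 0 (x 0) with h0 | h0
    · rw [hvdef, negPartHalf_of_pos h0, max_eq_right_iff, neg_nonpos, hwdef]
      by_cases h1 : x ∈ halfBall N (2 * r)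
      · have h2 : x ∈ closedBall (r • e1 N) (r / 2) := by
          by_contra h2; exact hxU ⟨h1, h2⟩
        have := hεu x h2
        nlinarith [hφ.le_one_closedBall hr x h2]
      · simp only [hφ.eq_zero x ⟨h0, h1⟩, mul_zero, sub_zero]
        exact hx h0
    · exact negPartHalf_of_nonpos h0
  have hvball : ∀ᵐ x, x ∉ ball (0 : E N) (2 * r) → v x = 0 := by
    filter_upwards [hv0] with x hx h
    exact hx fun h' => h h'.1.1
  have hvΩ : ∀ᵐ x, x ∉ halfBall N R → v x = 0 := by
    filter_upwards [hv0] with x hx h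
    exact hx fun h' => h (hsub h'.1)
  have hv1 : Integrable v := integrable_of_memLp_two hvH.memLp hvball
  obtain ⟨L, -, hL⟩ := exists_lipschitz_bound hφ.smooth hφ.compactSupport
  obtain ⟨hLi, hLe⟩ := logForm_eq_integral_logLaplacian hφ.smooth.continuous hφ.compactSupport hL
    hv1 hvH.memLp
  have hmeas : MeasurableSet (halfBall N R) := (isOpen_halfBall R).measurableSet
  have hweak : ∫ x in halfBall N R, V x * u x * v x ≤ logForm u v :=
    hsuper.le_form v ⟨hvH, hvΩ⟩ (Eventually.of_forall negPartHalf_nonneg)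
  have hLΩ : ∫ x in halfBall N R, logLaplacian φ x * v x = ∫ x, logLaplacian φ x * v x :=
    setIntegral_eq_integral_of_ae_compl_eq_zero (by
      filter_upwards [hvΩ] with x hx h; rw [hx h, mul_zero])
  have huv : Integrable (fun x => u x * v x) := hu.memLp.integrable_mul hvH.memLp
  have hVuv : IntegrableOn (fun x => V x * u x * v x) (halfBall N R) := by
    have := (huv.integrableOn (s := halfBall N R)).bdd_mul (c := M) hV.1 ((ae_restrict_iff' hmeas).2 hM)
    exact this.congr (Eventually.of_forall fun x => (mul_assoc _ _ _).symm)
  have hv2 := hvH.memLp.integrable_sq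
  -- On the support of `v`, the barrier inequality bounds the integrand below by `V w v = -V v² ≥ -M
  -- v²`.
  have hpt : -(M * ∫ x in halfBall N R, v x ^ 2) ≤
      (∫ x in halfBall N R, V x * u x * v x) - ε * ∫ x in halfBall N R, logLaplacian φ x * v x := by
    rw [← integral_const_mul, ← integral_neg, ← integral_const_mul,
      ← integral_sub hVuv (hLi.integrableOn.const_mul ε)]
    refine integral_mono_ae (hv2.integrableOn.const_mul M).neg
      (hVuv.sub (hLi.integrableOn.const_mul ε)) ((ae_restrict_iff' hmeas).2 ?_)
    filter_upwards [hM, hv0, hφ.subsolution] with x h1 h2 h3 hx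
    by_cases hxU : x ∈ halfBall N (2 * r) \ closedBall (r • e1 N) (r / 2)
    · have h4 := h3 ⟨hxU.1, fun h => hxU.2 (ball_subset_closedBall h)⟩
      have h5 : (w x + v x) * v x = 0 := add_negPartHalf_mul x
      have h6 : 0 ≤ v x := negPartHalf_nonneg x
      have h7 := mul_le_mul_of_nonneg_right h4 (mul_nonneg hε.le h6)
      have h8 := mul_le_mul_of_nonneg_right (le_of_abs_le (h1 hx)) (sq_nonneg (v x))
      have h9 : w x = u x - ε * φ x := rfl
      have h10 : V x * (u x * v x) - ε * V x * φ x * v x = -(V x * v x ^ 2) := by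
        linear_combination V x * h5 - V x * v x * h9
      linarith
    · simp [h2 hxU]
  have hM0 : ∫ x in halfBall N R, v x ^ 2 = ∫ x, v x ^ 2 :=
    setIntegral_eq_integral_of_ae_compl_eq_zero (by
      filter_upwards [hvΩ] with x hx h; rw [hx h]; simp)
  have h1 := logForm_sub_const_mul hu hφH hvH hv1 ε
  have h2 := logForm_negPartHalf_le hw ha hv1
  have h3 := le_logForm_of_small_support hvH (s := 2 * r) (by positivity) hr4 hvball
  have hsq0 : 0 ≤ ∫ x, v x ^ 2 := integral_nonneg fun x => sq_nonneg _
  have hzero : ∫ x, v x ^ 2 = 0 := by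
    rw [hM0, hLΩ, ← hLe] at hpt
    have h4 : logForm w v = logForm u v - ε * logForm φ v := h1
    have h5 : logForm w v ≤ -logForm v v := h2
    -- The lower bound through `M`, the folding inequality and coercivity combine; the factor is
    -- positive by `hT`.
    have h6 : (((∫ z, truncKer N (2 * (2 * r)) z) + rhoConst N) - M) * ∫ x, v x ^ 2 ≤ 0 := by
      linarith
    nlinarith
  have hvz := (integral_eq_zero_iff_of_nonneg (fun x => sq_nonneg (v x)) hv2).1 hzero
  refine le_of_ae_le_of_isOpen (isOpen_halfBall _)
    (continuous_const.mul hφ.smooth.continuous).continuousOn (hcont.mono hsub) ?_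
  filter_upwards [hvz] with x hx hxB
  have h4 : v x = 0 := by simpa using hx
  rw [hvdef, negPartHalf_of_pos hxB.2, max_eq_right_iff, neg_nonpos] at h4
  exact sub_nonneg.1 h4

lemma exists_pos_le_closedBall {R r : ℝ} {u : E N → ℝ} (hr : 0 < r) (hrR : 2 * r ≤ R)
    (hcont : ContinuousOn u (halfBall N R)) (hpos : ∀ x ∈ halfBall N R, 0 < u x) :
    ∃ ε₀ : ℝ, 0 < ε₀ ∧ ∀ x ∈ closedBall (r • e1 N) (r / 2), ε₀ ≤ u x := by
  have hsub := (closedBall_subset_halfBall (N := N) hr).trans (halfBall_subset hrR)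
  obtain ⟨x, hx, hmin⟩ := (isCompact_closedBall (r • e1 N) (r / 2)).exists_isMinOn
    (nonempty_closedBall.2 (by positivity)) (hcont.mono hsub)
  exact ⟨u x, hpos x (hsub hx), fun y hy => hmin hy⟩

/-- Antisymmetry holds only almost everywhere; continuity makes it pointwise, and the origin is a
fixed point of the reflection. -/
lemma IsBarrier.apply_zero {V : E N → ℝ} {r : ℝ} {φ : E N → ℝ} (h : IsBarrier V r φ) :
    φ 0 = 0 := by
  have h1 : (fun x => φ (hyperRefl N x)) = fun x => -φ x :=
    Continuous.ae_eq_iff_eq volume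
      (h.smooth.continuous.comp (hyperRefl N).continuous) h.smooth.continuous.neg |>.1
      (antisymmetric_iff.1 h.antisymmetric)
  have h2 := congrFun h1 0
  simp only [map_zero] at h2
  linarith

/-- A function above a multiple of a barrier has positive lower slope at the origin. -/
lemma IsBarrier.liminf_pos {V u φ : E N → ℝ} {r ε : ℝ} (hr : 0 < r) (hφ : IsBarrier V r φ)
    (hε : 0 < ε) (hle : ∀ x ∈ halfBall N (2 * r), ε * φ x ≤ u x) :
    0 < liminf (fun h : ℝ => ((u (h • e1 N) / h : ℝ) : EReal)) (𝓝[>] 0) := by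
  set d := fderiv ℝ φ 0 (e1 N) with hd
  have hdpos : 0 < d := hφ.deriv_pos
  have hline : HasDerivAt (fun h : ℝ => φ (h • e1 N)) d 0 := by
    have h1 : HasFDerivAt φ (fderiv ℝ φ 0) ((0 : ℝ) • e1 N) := by
      rw [zero_smul]
      exact (hφ.smooth.differentiable (by simp)).differentiableAt.hasFDerivAt
    have h2 : HasDerivAt (fun h : ℝ => h • e1 N) (e1 N) 0 := by
      simpa using (hasDerivAt_id (0 : ℝ)).smul_const (e1 N)
    exact h1.comp_hasDerivAt 0 h2
  have ht : Tendsto (fun h : ℝ => φ (h • e1 N) / h) (𝓝[>] 0) (𝓝 d) := by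
    have := hline.tendsto_slope_zero_right
    simpa [hφ.apply_zero, div_eq_inv_mul] using this
  have hev : ∀ᶠ h : ℝ in 𝓝[>] 0, ((ε * (d / 2) : ℝ) : EReal) ≤ ((u (h • e1 N) / h : ℝ) : EReal) := by
    filter_upwards [ht.eventually (lt_mem_nhds (half_lt_self hdpos)),
      Ioo_mem_nhdsGT (show (0 : ℝ) < 2 * r by positivity)] with h h1 h2
    have hmem : h • e1 N ∈ halfBall N (2 * r) := by
      refine ⟨?_, ?_⟩
      · rw [mem_ball_zero_iff, norm_smul, norm_e1, Real.norm_of_nonneg h2.1.le, mul_one]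
        exact h2.2
      · change 0 < (h • e1 N) 0
        simpa [e1_apply_zero] using h2.1
    rw [EReal.coe_le_coe_iff, le_div_iff₀ h2.1]
    rw [lt_div_iff₀ h2.1] at h1
    have := hle _ hmem
    nlinarith
  refine lt_of_lt_of_le ?_ (le_liminf_of_le (by isBoundedDefault) hev)
  exact_mod_cast mul_pos hε (half_pos hdpos)

end Comparison

/-! ### Linear vanishing of smooth antisymmetric functions and their logarithmic Laplacians. -/

section PointwiseEstimate

variable {N : ℕ} [NeZero N] {ψ : E N → ℝ} {L : ℝ}

lemma norm_sub_hyperRefl_self (x : E N) : ‖x - hyperRefl N x‖ = 2 * |x 0| := by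
  rw [hyperRefl_apply, sub_sub_cancel, norm_smul, norm_e1, mul_one, Real.norm_eq_abs, abs_mul,
    abs_two]

lemma integrable_mul_jKer (hψ : Continuous ψ) (hc : HasCompactSupport ψ) (x : E N) :
    Integrable (fun z => ψ (x - z) * jKer N z) := by
  have hi : Integrable (fun z => ψ (x - z)) := (hψ.integrable_of_hasCompactSupport hc).comp_sub_left x
  refine hi.mul_bdd (c := cConst N) measurable_jKer.aestronglyMeasurable
    (Eventually.of_forall fun z => ?_)
  rw [Real.norm_of_nonneg (jKer_nonneg z)]
  exact jKer_le z

lemma integrable_sub_mul_kKer (hψ : Continuous ψ) (hL : ∀ x y, |ψ x - ψ y| ≤ L * ‖x - y‖)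
    (x : E N) : Integrable (fun z => (ψ x - ψ (x - z)) * kKer N z) := by
  refine (integrable_norm_mul_kKer.const_mul L).mono'
    ((Continuous.aestronglyMeasurable (by fun_prop)).mul measurable_kKer.aestronglyMeasurable)
    (Eventually.of_forall fun z => ?_)
  rw [norm_mul, Real.norm_of_nonneg (kKer_nonneg z), ← mul_assoc]
  have := hL x (x - z)
  rw [sub_sub_cancel] at this
  exact mul_le_mul_of_nonneg_right this (kKer_nonneg z)

lemma integrable_logLaplacian_integrand (hψ : Continuous ψ) (hc : HasCompactSupport ψ)
    (hL : ∀ x y, |ψ x - ψ y| ≤ L * ‖x - y‖) (x : E N) :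
    Integrable (fun z => (ψ x - ψ (x - z)) * kKer N z - ψ (x - z) * jKer N z) :=
  (integrable_sub_mul_kKer hψ hL x).sub (integrable_mul_jKer hψ hc x)

omit [NeZero N] in
lemma logLaplacian_eq_shift (x : E N) : logLaplacian ψ x =
    (∫ z, ((ψ x - ψ (x - z)) * kKer N z - ψ (x - z) * jKer N z)) + rhoConst N * ψ x := by
  rw [logLaplacian_eq, ← integral_sub_left_eq_self _ _ x]
  simp only [sub_sub_cancel]

lemma logLaplacian_mul_add {η : E N → ℝ} (hψ : ContDiff ℝ ∞ ψ) (hψc : HasCompactSupport ψ)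
    (hη : ContDiff ℝ ∞ η) (hηc : HasCompactSupport η) (s α : ℝ) (x : E N) :
    logLaplacian (fun x => s * (α * ψ x + η x)) x =
      s * (α * logLaplacian ψ x + logLaplacian η x) := by
  obtain ⟨L₁, -, hL₁⟩ := exists_lipschitz_bound hψ hψc
  obtain ⟨L₂, -, hL₂⟩ := exists_lipschitz_bound hη hηc
  have i1 := integrable_logLaplacian_integrand hψ.continuous hψc hL₁ x
  have i2 := integrable_logLaplacian_integrand hη.continuous hηc hL₂ x
  rw [logLaplacian_eq_shift, logLaplacian_eq_shift, logLaplacian_eq_shift]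
  have : ∫ z, ((s * (α * ψ x + η x) - s * (α * ψ (x - z) + η (x - z))) * kKer N z -
      s * (α * ψ (x - z) + η (x - z)) * jKer N z) =
      s * (α * (∫ z, ((ψ x - ψ (x - z)) * kKer N z - ψ (x - z) * jKer N z)) +
        ∫ z, ((η x - η (x - z)) * kKer N z - η (x - z) * jKer N z)) := by
    rw [← integral_const_mul α, ← integral_add (i1.const_mul α) i2, ← integral_const_mul]
    congr 1; ext z; ring
  rw [this]; ring

lemma logLaplacian_hyperRefl (ha : ∀ x, ψ (hyperRefl N x) = -ψ x) (x : E N) :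
    logLaplacian ψ (hyperRefl N x) = -logLaplacian ψ x := by
  rw [logLaplacian_eq, logLaplacian_eq, ha, neg_add, ← integral_neg]
  rw [← (measurePreserving_hyperRefl (N := N)).integral_comp
    (hyperRefl N).toHomeomorph.measurableEmbedding]
  congr 1
  · congr 1; ext y
    rw [ha, ← map_sub, kKer_congr (norm_hyperRefl (x - y)), jKer_congr (norm_hyperRefl (x - y))]
    ring
  · ring

-- The mean value inequality is applied to `t ↦ ψ t - ψ (t + (x' - x))`, whose derivative is small
-- because `fderiv ℝ ψ` is Lipschitz. The factor `‖z‖` tames the singularity and `‖x - x'‖` gives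
-- the linear decay.
omit [NeZero N] in
lemma exists_second_difference_bound (hψ : ContDiff ℝ ∞ ψ) (hc : HasCompactSupport ψ) :
    ∃ C : ℝ, 0 ≤ C ∧ ∀ x x' z, |(ψ x - ψ x') - (ψ (x - z) - ψ (x' - z))| ≤ C * ‖x - x'‖ * ‖z‖ := by
  have h1 : ContDiff ℝ ∞ (fderiv ℝ ψ) := hψ.fderiv_right (by simp)
  obtain ⟨C, hC⟩ := ContDiff.lipschitzWith_of_hasCompactSupport (hc.fderiv ℝ) h1 (by simp)
  refine ⟨C, C.2, fun x x' z => ?_⟩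
  have hd : Differentiable ℝ ψ := hψ.differentiable (by simp)
  have hg : ∀ t, HasFDerivAt (fun t => ψ t - ψ (t + (x' - x)))
      (fderiv ℝ ψ t - fderiv ℝ ψ (t + (x' - x))) t := fun t =>
    (hd t).hasFDerivAt.sub ((hasFDerivAt_comp_add_right (x' - x)).2 (hd _).hasFDerivAt)
  have h2 := Convex.norm_image_sub_le_of_norm_hasFDerivWithin_le (s := univ)
    (C := C * ‖x - x'‖) (fun t _ => (hg t).hasFDerivWithinAt) (fun t _ => by
      have := hC.dist_le_mul t (t + (x' - x))
      rw [dist_eq_norm, dist_eq_norm] at this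
      refine this.trans_eq ?_
      rw [sub_add_cancel_left, neg_sub]) convex_univ (mem_univ (x - z)) (mem_univ x)
  simp only [sub_sub_cancel, add_sub_cancel, Real.norm_eq_abs] at h2
  rwa [show x - z + (x' - x) = x' - z by abel] at h2

/-- The logarithmic Laplacian of an antisymmetric test function vanishes linearly on the
hyperplane. -/
lemma exists_abs_logLaplacian_le (hψ : ContDiff ℝ ∞ ψ) (hc : HasCompactSupport ψ)
    (ha : ∀ x, ψ (hyperRefl N x) = -ψ x) :
    ∃ C : ℝ, 0 ≤ C ∧ ∀ x, |logLaplacian ψ x| ≤ C * |x 0| := by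
  obtain ⟨L, hL0, hL⟩ := exists_lipschitz_bound hψ hc
  obtain ⟨C, hC0, hC⟩ := exists_second_difference_bound hψ hc
  have hcc := (cConst_pos (N := N)).le
  set S : E N → ℝ := (tsupport ψ).indicator (fun _ => (1 : ℝ)) with hSdef
  have hS0 : ∀ x, 0 ≤ S x := fun x => indicator_nonneg (fun _ _ => zero_le_one) x
  have hS : Integrable S :=
    (integrable_indicator_iff hc.isCompact.measurableSet).2 (by simp [hc.isCompact.measure_lt_top])
  have hI0 : 0 ≤ ∫ z : E N, ‖z‖ * kKer N z :=
    integral_nonneg fun z => mul_nonneg (norm_nonneg _) (kKer_nonneg z)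
  have hIS : 0 ≤ ∫ z, S z := integral_nonneg hS0
  refine ⟨C * (∫ z : E N, ‖z‖ * kKer N z) + 2 * (cConst N * L * ∫ z, S z) + |rhoConst N| * L,
    by positivity, fun x => ?_⟩
  set x' := hyperRefl N x with hx'
  have hxx : ‖x - x'‖ = 2 * |x 0| := norm_sub_hyperRefl_self x
  -- By oddness `2 L_Δ ψ(x) = L_Δ ψ(x) - L_Δ ψ(x')`, so a Lipschitz estimate in `x` at distance `2
  -- |x₁|` is enough.
  have hodd : logLaplacian ψ x' = -logLaplacian ψ x := logLaplacian_hyperRefl ha x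
  have i1 := integrable_logLaplacian_integrand hψ.continuous hc hL x
  have i2 := integrable_logLaplacian_integrand hψ.continuous hc hL x'
  have hSx : ∀ a : E N, Integrable (fun z => S (a - z)) := fun a => hS.comp_sub_left a
  have ib1 : Integrable (fun z : E N => C * ‖x - x'‖ * (‖z‖ * kKer N z)) :=
    integrable_norm_mul_kKer.const_mul _
  -- Since `j` is not integrable, the far part is bounded by `c_N` times the indicators `S` of the
  -- support.
  have ib2 : Integrable (fun z : E N => cConst N * L * ‖x - x'‖ * (S (x - z) + S (x' - z))) :=
    ((hSx x).add (hSx x')).const_mul _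
  have hb := norm_integral_le_of_norm_le (f := fun z =>
      ((ψ x - ψ (x - z)) * kKer N z - ψ (x - z) * jKer N z) -
      ((ψ x' - ψ (x' - z)) * kKer N z - ψ (x' - z) * jKer N z)) (ib1.add ib2)
    (Eventually.of_forall fun z => by
      have hk := kKer_nonneg z
      have hj := jKer_nonneg z
      have e : ((ψ x - ψ (x - z)) * kKer N z - ψ (x - z) * jKer N z) -
          ((ψ x' - ψ (x' - z)) * kKer N z - ψ (x' - z) * jKer N z) =
          ((ψ x - ψ x') - (ψ (x - z) - ψ (x' - z))) * kKer N z -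
          (ψ (x - z) - ψ (x' - z)) * jKer N z := by ring
      rw [e]
      refine (norm_sub_le _ _).trans (add_le_add ?_ ?_)
      · rw [norm_mul, Real.norm_of_nonneg hk]
        exact (mul_le_mul_of_nonneg_right (hC x x' z) hk).trans_eq (mul_assoc _ _ _)
      · rw [norm_mul, Real.norm_of_nonneg hj]
        by_cases h : x - z ∉ tsupport ψ ∧ x' - z ∉ tsupport ψ
        · rw [image_eq_zero_of_notMem_tsupport h.1, image_eq_zero_of_notMem_tsupport h.2]
          simp only [sub_self, norm_zero, zero_mul]
          have := hS0 (x - z)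
          have := hS0 (x' - z)
          positivity
        · have h2 : 1 ≤ S (x - z) + S (x' - z) := by
            rw [not_and_or, not_not, not_not] at h
            rcases h with h | h
            · rw [hSdef, indicator_of_mem h]; linarith [hS0 (x' - z)]
            · rw [hSdef, indicator_of_mem h]; linarith [hS0 (x - z)]
          have h3 := hL (x - z) (x' - z)
          rw [sub_sub_sub_cancel_right] at h3
          calc _ ≤ (L * ‖x - x'‖) * cConst N := by
                gcongr
                · exact h3
                · exact jKer_le z
            _ = cConst N * L * ‖x - x'‖ * 1 := by ring
            _ ≤ cConst N * L * ‖x - x'‖ * (S (x - z) + S (x' - z)) := by gcongr)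
  rw [integral_sub i1 i2] at hb
  have hbe : ∫ z : E N, ((fun z : E N => C * ‖x - x'‖ * (‖z‖ * kKer N z)) +
      fun z => cConst N * L * ‖x - x'‖ * (S (x - z) + S (x' - z))) z =
      2 * |x 0| * (C * (∫ z : E N, ‖z‖ * kKer N z) + 2 * (cConst N * L * ∫ z, S z)) := by
    simp only [Pi.add_apply]
    rw [integral_add ib1 ib2, integral_const_mul, integral_const_mul,
      integral_add (hSx x) (hSx x'), integral_sub_left_eq_self, integral_sub_left_eq_self, hxx]
    ring
  rw [hbe] at hb
  have e1 := logLaplacian_eq_shift (ψ := ψ) x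
  have e2 := logLaplacian_eq_shift (ψ := ψ) x'
  have hψx : |ψ x| ≤ L * |x 0| := by
    have := hL x x'
    rw [hxx, hx', ha, sub_neg_eq_add, ← two_mul, abs_mul, abs_two] at this
    linarith
  have e3 : 2 * logLaplacian ψ x =
      ((∫ z, ((ψ x - ψ (x - z)) * kKer N z - ψ (x - z) * jKer N z)) -
      ∫ z, ((ψ x' - ψ (x' - z)) * kKer N z - ψ (x' - z) * jKer N z)) +
      2 * (rhoConst N * ψ x) := by
    have : ψ x' = -ψ x := ha x
    rw [this] at e2 ⊢
    linarith
  have h4 : 2 * |logLaplacian ψ x| ≤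
      2 * |x 0| * (C * (∫ z : E N, ‖z‖ * kKer N z) + 2 * (cConst N * L * ∫ z, S z)) +
      2 * (|rhoConst N| * (L * |x 0|)) := by
    rw [← abs_two, ← abs_mul, e3, abs_two]
    refine (abs_add_le _ _).trans (add_le_add hb ?_)
    rw [abs_mul, abs_mul, abs_two]
    gcongr
  linarith

lemma exists_abs_le_of_antisymm (hψ : ContDiff ℝ ∞ ψ) (hc : HasCompactSupport ψ)
    (ha : ∀ x, ψ (hyperRefl N x) = -ψ x) :
    ∃ C : ℝ, 0 ≤ C ∧ ∀ x, |ψ x| ≤ C * |x 0| := by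
  obtain ⟨L, hL0, hL⟩ := exists_lipschitz_bound hψ hc
  refine ⟨L, hL0, fun x => ?_⟩
  have := hL x (hyperRefl N x)
  rw [norm_sub_hyperRefl_self, ha, sub_neg_eq_add, ← two_mul, abs_mul, abs_two] at this
  linarith

end PointwiseEstimate

/-! ### Construction of barriers. -/

section BarrierConstruction

variable {N : ℕ} [NeZero N]

/-- The antisymmetrization of a function across `{x₁ = 0}`. -/
def antisymm (p : E N → ℝ) (x : E N) : ℝ := p x - p (hyperRefl N x)

lemma antisymm_hyperRefl (p : E N → ℝ) (x : E N) :
    antisymm p (hyperRefl N x) = -antisymm p x := by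
  simp only [antisymm, hyperRefl_hyperRefl]; ring

lemma contDiff_antisymm {p : E N → ℝ} (hp : ContDiff ℝ ∞ p) : ContDiff ℝ ∞ (antisymm p) :=
  hp.sub (hp.comp (hyperRefl N).contDiff)

lemma hasCompactSupport_antisymm {p : E N → ℝ} (hp : HasCompactSupport p) :
    HasCompactSupport (antisymm p) :=
  hp.sub (hp.comp_homeomorph (hyperRefl N).toHomeomorph)

/-- With `a`, `b` the direct and reflected distances, `b² - a² = 4 x₁ y₁ ≥ 3 r x₁`, so `1 - a/b ≥
(b² - a²)/(2b²) ≥ (3/2) r x₁ / b²`. The powers are handled by `(a/b)^N ≤ a/b` and `a ≤ b ≤ 4r`. -/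
lemma kernel_sub_kernel_ge {r : ℝ} (hr : 0 < r) {x y : E N} (hx0 : 0 ≤ x 0)
    (hy0 : 3 / 4 * r ≤ y 0) (hx : ‖x‖ ≤ 2 * r) (hy : ‖y‖ ≤ 2 * r) (hxy : x - y ≠ 0) :
    cConst N * (3 / 2 * r / ((4 * r) ^ 2 * (4 * r) ^ N)) * x 0 ≤
      cConst N / ‖x - y‖ ^ N - cConst N / ‖x - hyperRefl N y‖ ^ N := by
  have hc := (cConst_pos (N := N)).le
  set a := ‖x - y‖ with ha
  set b := ‖x - hyperRefl N y‖ with hb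
  have ha0 : 0 < a := norm_pos_iff.2 hxy
  have hy0' : 0 < y 0 := lt_of_lt_of_le (by positivity) hy0
  have hsq : b ^ 2 = a ^ 2 + 4 * (x 0 * y 0) := norm_sub_hyperRefl_sq x y
  have hab : a ≤ b := norm_sub_le_hyperRefl (mul_nonneg hx0 hy0'.le)
  have hb0 : 0 < b := ha0.trans_le hab
  have hb4 : b ≤ 4 * r := by
    have := norm_sub_le x (hyperRefl N y)
    rw [norm_hyperRefl] at this
    linarith
  have h1 : a / b ≤ 1 := (div_le_one hb0).2 hab
  have h2 : 1 / b ^ N ≤ 1 / a ^ N * (a / b) := by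
    have h3 : (a / b) ^ N ≤ a / b := pow_le_of_le_one (by positivity) h1 (NeZero.ne N)
    have h4 : 1 / b ^ N = 1 / a ^ N * (a / b) ^ N := by
      rw [div_pow]; field_simp
    rw [h4]; gcongr
  have h5 : 3 / 2 * r * x 0 / b ^ 2 ≤ 1 - a / b := by
    rw [div_le_iff₀ (by positivity)]
    have h6 : (1 - a / b) * b ^ 2 = b ^ 2 - a * b := by field_simp
    rw [h6]
    nlinarith [mul_le_mul_of_nonneg_left hy0 hx0, sq_nonneg (b - a)]
  have h7 : 3 / 2 * r / ((4 * r) ^ 2 * (4 * r) ^ N) * x 0 ≤ 1 / a ^ N * (1 - a / b) := by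
    calc 3 / 2 * r / ((4 * r) ^ 2 * (4 * r) ^ N) * x 0
        = 1 / (4 * r) ^ N * (3 / 2 * r * x 0 / (4 * r) ^ 2) := by field_simp
      _ ≤ 1 / a ^ N * (3 / 2 * r * x 0 / b ^ 2) := by gcongr; exact hab.trans hb4
      _ ≤ _ := by gcongr
  calc _ = cConst N * (3 / 2 * r / ((4 * r) ^ 2 * (4 * r) ^ N) * x 0) := by ring
    _ ≤ cConst N * (1 / a ^ N * (1 - a / b)) := by gcongr
    _ ≤ cConst N * (1 / a ^ N - 1 / b ^ N) := by gcongr; linarith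
    _ = _ := by ring

lemma integrable_mul_div_norm_pow {b : E N → ℝ} (hb : Continuous b) (hc : HasCompactSupport b)
    {x : E N} {δ : ℝ} (hδ : 0 < δ) (h : ∀ y, b y ≠ 0 → δ ≤ ‖x - y‖) :
    Integrable (fun y => b y * (cConst N / ‖x - y‖ ^ N)) := by
  have hcc := (cConst_pos (N := N)).le
  refine ((hb.integrable_of_hasCompactSupport hc).abs.mul_const (cConst N / δ ^ N)).mono'
    (hb.aestronglyMeasurable.mul (Measurable.aestronglyMeasurable (by fun_prop)))
    (Eventually.of_forall fun y => ?_)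
  rw [norm_mul, Real.norm_of_nonneg (show 0 ≤ cConst N / ‖x - y‖ ^ N by positivity),
    Real.norm_eq_abs]
  by_cases hy : b y = 0
  · simp [hy]
  · have := h y hy
    gcongr

/-- The logarithmic Laplacian of an antisymmetrized bump is negative away from the bump. -/
lemma logLaplacian_antisymm_bump_le {r : ℝ} (hr : 0 < r) (b : ContDiffBump (r • e1 N))
    (hb : b.rOut = r / 4) {x : E N} (hx : x ∈ halfBall N (2 * r) \ ball (r • e1 N) (r / 2)) :
    logLaplacian (antisymm b) x ≤
      -(cConst N * (3 / 2 * r / ((4 * r) ^ 2 * (4 * r) ^ N)) * (∫ y, b y)) * x 0 := by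
  have hx0 : 0 < x 0 := hx.1.2
  have hxn : ‖x‖ < 2 * r := mem_ball_zero_iff.1 hx.1.1
  have hxd : r / 2 ≤ ‖x - r • e1 N‖ := by
    simpa [dist_eq_norm] using hx.2
  have hbs : ∀ y, b y ≠ 0 → ‖y - r • e1 N‖ < r / 4 := by
    intro y hy
    have : y ∈ Function.support b := hy
    rwa [b.support_eq, hb, mem_ball, dist_eq_norm] at this
  have hby : ∀ y, b y ≠ 0 → 3 / 4 * r ≤ y 0 ∧ ‖y‖ ≤ 2 * r ∧ r / 4 ≤ ‖x - y‖ := by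
    intro y hy
    have h1 := hbs y hy
    refine ⟨?_, ?_, ?_⟩
    · have h2 := (abs_coord_le_norm (y - r • e1 N)).trans h1.le
      simp only [PiLp.sub_apply, PiLp.smul_apply, e1_apply_zero, smul_eq_mul, mul_one] at h2
      linarith [(abs_le.1 h2).1]
    · have h2 : ‖y‖ ≤ ‖y - r • e1 N‖ + ‖r • e1 N‖ := by
        simpa using norm_add_le (y - r • e1 N) (r • e1 N)
      rw [norm_smul, norm_e1, Real.norm_of_nonneg hr.le] at h2
      linarith
    · have h2 := norm_add_le (x - y) (y - r • e1 N)
      rw [sub_add_sub_cancel] at h2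
      linarith
  have hbx : b x = 0 := by
    by_contra h
    linarith [hbs x h]
  have hbx' : b (hyperRefl N x) = 0 := by
    by_contra h
    have := (hby _ h).1
    rw [hyperRefl_coord] at this
    linarith
  have hbc : Continuous b := b.contDiff (n := 0) |>.continuous
  have hfar : ∀ y, b y ≠ 0 → r / 4 ≤ ‖x - hyperRefl N y‖ := fun y hy => by
    obtain ⟨h1, -, h3⟩ := hby y hy
    exact h3.trans (norm_sub_le_hyperRefl (mul_nonneg hx0.le (le_trans (by positivity) h1)))
  have i1 := integrable_mul_div_norm_pow hbc b.hasCompactSupport (x := x) (δ := r / 4)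
    (by positivity) (fun y hy => (hby y hy).2.2)
  have i2' : Integrable (fun y => b (hyperRefl N y) * (cConst N / ‖x - y‖ ^ N)) := by
    refine integrable_mul_div_norm_pow (hbc.comp (hyperRefl N).continuous)
      (b.hasCompactSupport.comp_homeomorph (hyperRefl N).toHomeomorph) (x := x) (δ := r / 4)
      (by positivity) fun y hy => ?_
    have := hfar _ hy
    rwa [hyperRefl_hyperRefl] at this
  have e2 : ∀ y, (fun y => b (hyperRefl N y) * (cConst N / ‖x - y‖ ^ N)) (hyperRefl N y) =
      b y * (cConst N / ‖x - hyperRefl N y‖ ^ N) := fun y => by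
    simp only [hyperRefl_hyperRefl]
  have i2 : Integrable (fun y => b y * (cConst N / ‖x - hyperRefl N y‖ ^ N)) :=
    ((measurePreserving_hyperRefl (N := N)).integrable_comp_of_integrable i2').congr
      (Eventually.of_forall e2)
  have hint2 : ∫ y, b (hyperRefl N y) * (cConst N / ‖x - y‖ ^ N) =
      ∫ y, b y * (cConst N / ‖x - hyperRefl N y‖ ^ N) := by
    rw [← (measurePreserving_hyperRefl (N := N)).integral_comp
      (hyperRefl N).toHomeomorph.measurableEmbedding]
    exact integral_congr_ae (Eventually.of_forall e2)
  have hηx : antisymm b x = 0 := by rw [antisymm, hbx, hbx', sub_zero]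
  -- Since the function vanishes at `x`, only the integral against the full kernel remains;
  -- reflecting the second bump turns it into a kernel difference.
  have hL : logLaplacian (antisymm b) x =
      -∫ y, (b y * (cConst N / ‖x - y‖ ^ N) - b y * (cConst N / ‖x - hyperRefl N y‖ ^ N)) := by
    rw [logLaplacian_eq, hηx, mul_zero, add_zero, integral_sub i1 i2, ← hint2,
      ← integral_sub i1 i2', ← integral_neg]
    congr 1; ext y
    rw [← kKer_add_jKer, antisymm]
    ring
  rw [hL, neg_mul, neg_le_neg_iff, mul_right_comm, ← integral_const_mul]
  refine integral_mono ((b.integrable).const_mul _) (i1.sub i2) fun y => ?_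
  simp only
  by_cases hy : b y = 0
  · simp [hy]
  · obtain ⟨h1, h2, h3⟩ := hby y hy
    have h4 := kernel_sub_kernel_ge hr hx0.le h1 hxn.le h2
      (norm_pos_iff.1 (lt_of_lt_of_le (by positivity) h3))
    have := mul_le_mul_of_nonneg_right h4 (b.nonneg' y)
    linarith

/-- The bump at `r e₁` makes `L_Δ` negative at rate `κ x₁` but is flat at 0. A small multiple of a
function equal to `2 x₁` near 0 adds the slope at a cost of order `x₁`. -/
lemma exists_isBarrier {R r M : ℝ} {V : E N → ℝ} (hM0 : 0 ≤ M)
    (hM : ∀ᵐ x, x ∈ halfBall N R → |V x| ≤ M) (hr : 0 < r) (hrR : 2 * r ≤ R) :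
    ∃ φ : E N → ℝ, IsBarrier V r φ := by
  set b : ContDiffBump (r • e1 N) := ⟨r / 8, r / 4, by positivity, by linarith⟩
  set g : ContDiffBump (0 : E N) := ⟨r / 8, r / 4, by positivity, by linarith⟩
  set p : E N → ℝ := fun x => x 0 * g x with hp
  have hpc : ContDiff ℝ ∞ p := ContDiff.mul (by fun_prop) g.contDiff
  have hps : HasCompactSupport p := g.hasCompactSupport.mul_left
  set ψ := antisymm p with hψdef
  set η := antisymm (b : E N → ℝ) with hηdef
  have hψ : ContDiff ℝ ∞ ψ := contDiff_antisymm hpc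
  have hψc : HasCompactSupport ψ := hasCompactSupport_antisymm hps
  have hη : ContDiff ℝ ∞ η := contDiff_antisymm b.contDiff
  have hηc : HasCompactSupport η := hasCompactSupport_antisymm b.hasCompactSupport
  obtain ⟨C, hC0, hC⟩ := exists_abs_logLaplacian_le hψ hψc (antisymm_hyperRefl p)
  obtain ⟨D, hD0, hD⟩ := exists_abs_le_of_antisymm hψ hψc (antisymm_hyperRefl p)
  set κ := cConst N * (3 / 2 * r / ((4 * r) ^ 2 * (4 * r) ^ N)) * (∫ y, b y) with hκ
  have hκ0 : 0 < κ := by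
    have := cConst_pos (N := N)
    have := b.integral_pos (μ := volume)
    positivity
  -- Chosen so that `α (C + M D) ≤ κ`; the `1` keeps the denominator positive.
  set α := κ / (C + M * D + 1) with hα
  have hα0 : 0 < α := by positivity
  have hακ : α * (C + M * D) ≤ κ := by
    rw [hα, div_mul_eq_mul_div, div_le_iff₀ (by positivity)]
    nlinarith
  set f : E N → ℝ := fun x => α * ψ x + η x with hf
  have hfs : ContDiff ℝ ∞ f := (contDiff_const.mul hψ).add hη
  have hfc : HasCompactSupport f := hψc.mul_left.add hηc
  obtain ⟨B, hB⟩ := hfs.continuous.bounded_above_of_compact_support hfc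
  have hB1 : 0 < |B| + 1 := by positivity
  -- Normalization for `φ ≤ 1`, with `B` a bound for `f`.
  set s := 1 / (|B| + 1) with hs
  have hs0 : 0 < s := by positivity
  have hbz : ∀ x : E N, b x ≠ 0 → x ∈ halfBall N (2 * r) := fun x hx => by
    have : x ∈ Function.support b := hx
    rw [b.support_eq] at this
    exact closedBall_subset_halfBall hr
      (ball_subset_closedBall (ball_subset_ball (by change r / 4 ≤ r / 2; linarith) this))
  have hgz : ∀ x : E N, g x ≠ 0 → ‖x‖ < 2 * r := fun x hx => by
    have : x ∈ Function.support g := hx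
    rw [g.support_eq, mem_ball_zero_iff] at this
    have h2 : g.rOut = r / 4 := rfl
    linarith
  have hbneg : ∀ x : E N, x 0 ≤ 0 → b x = 0 := fun x hx => by
    by_contra h
    have : 0 < x 0 := (hbz x h).2
    linarith
  have hbfar : ∀ x : E N, 2 * r ≤ ‖x‖ → b x = 0 := fun x hx => by
    by_contra h
    have := mem_ball_zero_iff.1 (hbz x h).1
    linarith
  have hgfar : ∀ x : E N, 2 * r ≤ ‖x‖ → g x = 0 := fun x hx => by
    by_contra h
    linarith [hgz x h]
  refine ⟨fun x => s * (α * ψ x + η x), contDiff_const.mul hfs, hfc.mul_left, ?_, ?_, ?_, ?_, ?_⟩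
  · refine antisymmetric_iff.2 (Eventually.of_forall fun x => ?_)
    simp only [hψdef, hηdef, antisymm_hyperRefl]
    ring
  · filter_upwards [hM] with x hMx hx
    have hx0 : 0 < x 0 := hx.1.2
    have hV := hMx (halfBall_subset hrR hx.1)
    have h1 := logLaplacian_antisymm_bump_le hr b rfl hx
    have h2 := (le_abs_self _).trans (hC x)
    have h3 := hD x
    rw [abs_of_pos hx0] at h2 h3
    rw [logLaplacian_mul_add hψ hψc hη hηc, mul_left_comm]
    have hηx : η x = 0 := by
      have h4 : b x = 0 := by
        by_contra h
        have h5 : x ∈ Function.support b := h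
        rw [b.support_eq] at h5
        exact hx.2 (ball_subset_ball (by change r / 4 ≤ r / 2; linarith) h5)
      rw [hηdef, antisymm, h4, hbneg _ (by rw [hyperRefl_coord]; linarith), sub_zero]
    rw [hηx, add_zero]
    refine mul_le_mul_of_nonneg_left ?_ hs0.le
    have h6 : -(M * (D * x 0)) ≤ V x * ψ x := by
      have : |V x * ψ x| ≤ M * (D * x 0) := by
        rw [abs_mul]; gcongr
      exact (abs_le.1 this).1
    calc α * logLaplacian ψ x + logLaplacian η x ≤ α * (C * x 0) + -κ * x 0 := by
          gcongr
      _ ≤ α * -(M * (D * x 0)) := by nlinarith [mul_le_mul_of_nonneg_right hακ hx0.le]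
      _ ≤ α * (V x * ψ x) := by gcongr
      _ = V x * (α * ψ x) := by ring
  · intro x hx
    have hxn : 2 * r ≤ ‖x‖ := by
      by_contra h
      exact hx.2 ⟨mem_ball_zero_iff.2 (not_le.1 h), hx.1⟩
    have hxn' : 2 * r ≤ ‖hyperRefl N x‖ := by rwa [norm_hyperRefl]
    simp only [hψdef, hηdef, antisymm, hp, hgfar x hxn, hgfar _ hxn', hbfar x hxn, hbfar _ hxn']
    simp
  · intro x _
    have h1 : f x ≤ |B| + 1 := by
      linarith [le_abs_self (f x), hB x, le_abs_self B, Real.norm_eq_abs (f x)]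
    change s * f x ≤ 1
    rw [hs, one_div, inv_mul_le_iff₀ hB1]
    linarith
  -- Near 0 the bump `b` and its reflection vanish and `g = 1`, so the barrier is exactly `2 s α
  -- x₁`.
  · have hev : (fun x => s * (α * ψ x + η x)) =ᶠ[𝓝 0]
        ⇑((s * α * 2) • (EuclideanSpace.proj 0 : E N →L[ℝ] ℝ)) := by
      filter_upwards [closedBall_mem_nhds (0 : E N) (show 0 < r / 8 by positivity)] with x hx
      have hx' : hyperRefl N x ∈ closedBall (0 : E N) (r / 8) := by
        rw [mem_closedBall_zero_iff] at hx ⊢; rwa [norm_hyperRefl]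
      have hb0 : ∀ y ∈ closedBall (0 : E N) (r / 8), b y = 0 := fun y hy => by
        by_contra h
        have h1 : y ∈ Function.support b := h
        rw [b.support_eq, mem_ball, dist_eq_norm] at h1
        rw [mem_closedBall_zero_iff] at hy
        have h2 := norm_sub_norm_le (r • e1 N) y
        rw [norm_smul, norm_e1, Real.norm_of_nonneg hr.le, norm_sub_rev] at h2
        have h3 : b.rOut = r / 4 := rfl
        linarith
      have hg1 : ∀ y ∈ closedBall (0 : E N) (r / 8), g y = 1 := fun y hy =>
        g.one_of_mem_closedBall hy
      simp only [hψdef, hηdef, antisymm, hp, hb0 x hx, hb0 _ hx', hg1 x hx, hg1 _ hx',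
        hyperRefl_coord]
      simp
      ring
    rw [hev.fderiv_eq, ContinuousLinearMap.fderiv]
    change 0 < s * α * 2 * (e1 N) 0
    rw [e1_apply_zero]
    positivity

end BarrierConstruction

end LogLap

end

/-! ### Choice of the scale and conclusion. -/

theorem mainTheorem8 (N : ℕ) [NeZero N] (R : ℝ) (hR : 0 < R)
    (u V : LogLap.E N → ℝ)
    (hV : MeasureTheory.MemLp V ⊤ (MeasureTheory.volume.restrict (LogLap.halfBall N R)))
    (hu : LogLap.MemH u)
    (hcont : ContinuousOn u (LogLap.halfBall N R))
    (hanti : LogLap.Antisymmetric (LogLap.e1 N) u)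
    (hsuper : LogLap.IsWeakSupersolution (LogLap.halfBall N R) (fun x => V x * u x) u)
    (hpos : ∀ x ∈ LogLap.halfBall N R, 0 < u x)
    (hnonneg : ∀ᵐ x ∂(MeasureTheory.volume : MeasureTheory.Measure (LogLap.E N)),
      x ∈ LogLap.halfSpace N → 0 ≤ u x) :
    (∃ r₀ : ℝ, 0 < r₀ ∧ 2 * r₀ ≤ R ∧ ∀ r : ℝ, 0 < r → r ≤ r₀ →
      (∃ φ : LogLap.E N → ℝ, LogLap.IsBarrier V r φ) ∧
      ∀ φ : LogLap.E N → ℝ, LogLap.IsBarrier V r φ →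
        ∃ ε₀ : ℝ, 0 < ε₀ ∧ ∀ ε : ℝ, 0 < ε → ε ≤ ε₀ →
          ∀ x ∈ LogLap.halfBall N (2 * r), ε * φ x ≤ u x) ∧
    0 < Filter.liminf (fun h : ℝ => ((u (h • LogLap.e1 N) / h : ℝ) : EReal))
      (nhdsWithin 0 (Set.Ioi 0)) := by
  obtain ⟨M, hM0, hM⟩ : ∃ M : ℝ, 0 ≤ M ∧
      ∀ᵐ x ∂(MeasureTheory.volume : MeasureTheory.Measure (LogLap.E N)),
        x ∈ LogLap.halfBall N R → |V x| ≤ M := by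
    refine ⟨(MeasureTheory.eLpNormEssSup V (MeasureTheory.volume.restrict
      (LogLap.halfBall N R))).toReal, ENNReal.toReal_nonneg, (MeasureTheory.ae_restrict_iff'
      (LogLap.isOpen_halfBall R).measurableSet).1 ?_⟩
    filter_upwards [MeasureTheory.ae_le_eLpNormEssSup (f := V)
      (μ := MeasureTheory.volume.restrict (LogLap.halfBall N R))] with x hx
    have h := ENNReal.toReal_mono (MeasureTheory.eLpNorm_exponent_top (f := V) ▸ hV.2.ne) hx
    rwa [toReal_enorm, Real.norm_eq_abs] at h
  obtain ⟨δ, hδ, hT⟩ : ∃ δ : ℝ, 0 < δ ∧ ∀ a : ℝ, 0 < a → a ≤ δ →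
      M - LogLap.rhoConst N < ∫ z, LogLap.truncKer N a z := by
    have h := LogLap.tendsto_integral_truncKer (N := N) |>.eventually_gt_atTop
      (M - LogLap.rhoConst N)
    obtain ⟨δ, hδ, h⟩ := mem_nhdsGT_iff_exists_Ioc_subset.1 h
    exact ⟨δ, hδ, fun a h1 h2 => h ⟨h1, h2⟩⟩
  have main : ∃ r₀ : ℝ, 0 < r₀ ∧ 2 * r₀ ≤ R ∧ ∀ r : ℝ, 0 < r → r ≤ r₀ →
      (∃ φ : LogLap.E N → ℝ, LogLap.IsBarrier V r φ) ∧
      ∀ φ : LogLap.E N → ℝ, LogLap.IsBarrier V r φ →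
        ∃ ε₀ : ℝ, 0 < ε₀ ∧ ∀ ε : ℝ, 0 < ε → ε ≤ ε₀ →
          ∀ x ∈ LogLap.halfBall N (2 * r), ε * φ x ≤ u x := by
    -- The support radius is `2r`, hence its diameter is at most `4r`: `1/4` makes the far term
    -- vanish, `δ/4` makes the truncated mass exceed `M - ρ_N`, and `R/2` keeps `B_{2r}⁺` inside
    -- `B_R⁺`.
    refine ⟨min (R / 2) (min (1 / 4) (δ / 4)), by positivity, ?_, fun r hr hr₀ => ?_⟩
    · linarith [min_le_left (R / 2) (min (1 / 4) (δ / 4))]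
    obtain ⟨h1, h2⟩ := le_min_iff.1 hr₀
    obtain ⟨h2, h3⟩ := le_min_iff.1 h2
    refine ⟨LogLap.exists_isBarrier hM0 hM hr (by linarith), fun φ hφ => ?_⟩
    obtain ⟨ε₀, hε₀, hle⟩ := LogLap.exists_pos_le_closedBall hr (by linarith) hcont hpos
    refine ⟨ε₀, hε₀, fun ε hε hεε => ?_⟩
    have := hT (2 * (2 * r)) (by positivity) (by linarith)
    exact hφ.mul_le hV hu hcont hanti hsuper hnonneg hM hr (by linarith) (by linarith)
      (by linarith) hε fun x hx => hεε.trans (hle x hx)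
  refine ⟨main, ?_⟩
  obtain ⟨r, hr, -, h⟩ := main
  obtain ⟨⟨φ, hφ⟩, hall⟩ := h r hr le_rfl
  obtain ⟨ε, hε, hle⟩ := hall φ hφ
  exact hφ.liminf_pos hr hε (hle ε hε le_rfl)
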